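/- Let $r\ge 2$ and $d\ge 1$ be integers, let $p_0,\dots,p_r$ and $m_0,\dots,m_r$ be positive integers, and let $a_0,\dots,a_r$ be integers. Let $\mathbb P^r_{(p_0,\dots,p_r)}(d;a_0,\dots,a_r)=\mathbb P^r_{(p_0,\dots,p_r)}/\mu_d$ be the quotient of the weighted projective space $\mathbb P^r_{(p_0,\dots,p_r)}=(\mathbb C^{r+1}\setminus\{0\})/\mathbb C^*$ (where $t\in\mathbb C^*$ acts by $x_i\mapsto t^{p_i}x_i$) by the action $\xi\cdot[x_0:\dots:x_r]=[\xi^{a_0}x_0:\dots:\xi^{a_r}x_r]$ of the group $\mu_d$ of complex $d$-th roots of unity. It carries the Zariski topology, and $\{x_i=0\}$ denotes the image of the coordinate hyperplane. Suppose that $d\mid a_im_i$ for $i=0,\dots,r$ and that each of the equations $$x_0^{m_0}+x_1^{m_1}+x_2^{m_2}=0,\qquad x_i^{m_i}+x_{i+1}^{m_{i+1}}=0\quad(2\le i\le r-1)$$ is weighted homogeneous with respect to the weights $(p_0,\dots,p_r)$. Let $\mathcal E\subset\mathbb P^r_{(p_0,\dots,p_r)}(d;a_0,\dots,a_r)$ be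 the set defined by this system. Assume that there is a point $A$ with $\mathcal E\cap\{x_i=0\}=\{A\}$ for every $i=2,\dots,r$, and that $a_ip_j-a_jp_i=0$ for all $i,j\in\{2,\dots,r\}$. Put $P:=\prod_{i=2}^r p_i$ and $Q:=a_i\prod_{j=2,\,j\ne i}^r p_j$, which is the same integer for every $i\in\{2,\dots,r\}$. Then: (i) the number of irreducible components of $\mathcal E$ is $$\frac{m_2\cdots m_r}{\operatorname{lcm}(m_2,\dots,m_r)};$$ (ii) all irreducible components of $\mathcal E$ contain the point $A$, and they are pairwise disjoint outside $A$; (iii) each irreducible component of $\mathcal E$ meets $\{x_0=0\}$ in exactly $$\frac{m_1\cdot\gcd\bigl(dP\cdot\gcd(p_1,p_2,\dots,p_r),\,(a_1P-p_1Q)\cdot\gcd(p_2,\dots,p_r)\bigr)}{dP\cdot\gcd(p_2,\dots,p_r)}$$ points, and meets $\{x_1=0\}$ in exactly $$\frac{m_0\cdot\gcd\bigl(dP\cdot\gcd(p_0,p_2,\dots,p_r),\,(a_0P-p_0Q)\cdot\gcd(p_2,\dots,p_r)\bigr)}{dP\cdot\gcd(p_2,\dots,p_r)}$$ points. -/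

import Mathlib

open MvPolynomial

noncomputable section

/-- The points of `ℂ^(r+1)` other than the origin. -/
abbrev PuncturedSpace (r : ℕ) : Type := {x : Fin (r + 1) → ℂ // x ≠ 0}

/-- The Zariski topology on `ℂ^(r+1) ∖ {0}`: the subspace topology obtained by viewing a point as
a closed point of the spectrum of `ℂ[x₀, …, x_r]`. -/
def zariskiPunctured (r : ℕ) : TopologicalSpace (PuncturedSpace r) :=
  TopologicalSpace.induced
    (fun x : PuncturedSpace r =>
      (pointToPoint x.1 : PrimeSpectrum (MvPolynomial (Fin (r + 1)) ℂ)))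
    PrimeSpectrum.zariskiTopology

/-- The orbit relation on `ℂ^(r+1) ∖ {0}` of the group `ℂ^* × μ_d`, where `t ∈ ℂ^*` multiplies the
coordinate `x_i` by `t ^ p_i`, and `ξ ∈ μ_d` multiplies `x_i` by `ξ ^ a_i`. -/
def weightedSetoid (r d : ℕ) (p : Fin (r + 1) → ℕ) (a : Fin (r + 1) → ℤ) :
    Setoid (PuncturedSpace r) where
  r x y := ∃ t : ℂˣ, ∃ ξ ∈ rootsOfUnity d ℂ,
    ∀ i, y.1 i = ((ξ ^ a i * t ^ p i : ℂˣ) : ℂ) * x.1 i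
  iseqv :=
    { refl := fun x => ⟨1, 1, one_mem _, fun i => by simp⟩
      symm := by
        rintro x y ⟨t, ξ, hξ, h⟩
        refine ⟨t⁻¹, ξ⁻¹, inv_mem hξ, fun i => ?_⟩
        rw [h i, ← mul_assoc, ← Units.val_mul]
        have : ξ⁻¹ ^ a i * t⁻¹ ^ p i * (ξ ^ a i * t ^ p i) = 1 := by
          rw [inv_zpow, inv_pow, ← mul_inv, inv_mul_cancel]
        rw [this, Units.val_one, one_mul]
      trans := by
        rintro x y z ⟨t, ξ, hξ, h⟩ ⟨t', ξ', hξ', h'⟩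
        refine ⟨t' * t, ξ' * ξ, mul_mem hξ' hξ, fun i => ?_⟩
        rw [h' i, h i, ← mul_assoc, ← Units.val_mul, mul_zpow, mul_pow,
          mul_mul_mul_comm] }

/-- The quotient `ℙ^r_p(d; a) = ℙ^r_p / μ_d` of the weighted projective space
`ℙ^r_p = (ℂ^(r+1) ∖ {0}) / ℂ^*`, as the set of orbits of `ℂ^* × μ_d` on `ℂ^(r+1) ∖ {0}`. -/
def WeightedProjQuot (r d : ℕ) (p : Fin (r + 1) → ℕ) (a : Fin (r + 1) → ℤ) : Type :=
  Quotient (weightedSetoid r d p a)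

namespace WeightedProjQuot

variable {r d : ℕ} {p : Fin (r + 1) → ℕ} {a : Fin (r + 1) → ℤ}

/-- The class `[x₀ : … : x_r]` of a nonzero vector. -/
def mk (x : PuncturedSpace r) : WeightedProjQuot r d p a :=
  Quotient.mk (weightedSetoid r d p a) x

/-- The Zariski topology on `ℙ^r_p(d; a)`: a set is closed if and only if its inverse image in
`ℂ^(r+1) ∖ {0}` is Zariski closed. -/
instance : TopologicalSpace (WeightedProjQuot r d p a) :=
  TopologicalSpace.coinduced mk (zariskiPunctured r)

/-- A subset of `ℙ^r_p(d; a)` is closed exactly if its cone is cut out by polynomials. -/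
theorem isClosed_iff (Z : Set (WeightedProjQuot r d p a)) :
    IsClosed Z ↔ ∃ S : Set (MvPolynomial (Fin (r + 1)) ℂ),
      ∀ x : PuncturedSpace r, mk x ∈ Z ↔ ∀ f ∈ S, eval x.1 f = 0 := by
  rw [isClosed_coinduced]
  unfold zariskiPunctured
  rw [isClosed_induced_iff]
  have key : ∀ (S : Set (MvPolynomial (Fin (r + 1)) ℂ)) (x : PuncturedSpace r),
      (pointToPoint x.1 : PrimeSpectrum (MvPolynomial (Fin (r + 1)) ℂ)) ∈
        PrimeSpectrum.zeroLocus S ↔ ∀ f ∈ S, eval x.1 f = 0 := by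
    intro S x
    rw [PrimeSpectrum.mem_zeroLocus]
    constructor
    · intro h f hf
      have := h hf
      simpa [pointToPoint, mem_vanishingIdeal_singleton_iff] using this
    · intro h f hf
      simpa [pointToPoint, mem_vanishingIdeal_singleton_iff] using h f hf
  constructor
  · rintro ⟨T, hT, hZ⟩
    obtain ⟨S, rfl⟩ := (PrimeSpectrum.isClosed_iff_zeroLocus _).1 hT
    refine ⟨S, fun x => ?_⟩
    rw [← key, ← Set.mem_preimage, ← hZ, Set.mem_preimage]
  · rintro ⟨S, hS⟩
    refine ⟨PrimeSpectrum.zeroLocus S, PrimeSpectrum.isClosed_zeroLocus S, ?_⟩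
    ext x
    rw [Set.mem_preimage, key, Set.mem_preimage, hS]

/-- The subset of `ℙ^r_p(d; a)` defined by the equations `f = 0` for `f ∈ S`: the classes of the
nonzero common zeros. -/
def zeroSet (S : Set (MvPolynomial (Fin (r + 1)) ℂ)) : Set (WeightedProjQuot r d p a) :=
  mk '' {x | ∀ f ∈ S, eval x.1 f = 0}

/-- The coordinate hyperplane `{x_i = 0}`. -/
def hyperplane (i : Fin (r + 1)) : Set (WeightedProjQuot r d p a) :=
  zeroSet {X i}

end WeightedProjQuot

/-- The left-hand sides of the equations `x₀^m₀ + x₁^m₁ + x₂^m₂ = 0` and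
`x_i^m_i + x_(i+1)^m_(i+1) = 0` for `2 ≤ i < r`. -/
def fermatSystem (r : ℕ) (m : Fin (r + 1) → ℕ) : Set (MvPolynomial (Fin (r + 1)) ℂ) :=
  {X 0 ^ m 0 + X 1 ^ m 1 + X 2 ^ m 2} ∪
    {f | ∃ i j : Fin (r + 1), 2 ≤ i.val ∧ j.val = i.val + 1 ∧ f = X i ^ m i + X j ^ m j}

/-- The irreducible components of a subset `E` of a topological space, for the subspace topology,
as subsets of the ambient space. -/
def componentsOf {Y : Type*} [TopologicalSpace Y] (E : Set Y) : Set (Set Y) :=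
  (fun C : Set E => Subtype.val '' C) '' irreducibleComponents E

/-- The indices `2, …, r`. -/
def tailIdx (r : ℕ) : Finset (Fin (r + 1)) :=
  Finset.univ.filter fun i => 2 ≤ i.val

end

/-!
All the products `p_i m_i` are equal by homogeneity (`exists_weight_mul_eq`). With
`g = gcd(p_2, …, p_r)`, `p_i = g q_i` and `N = q_i m_i = lcm(m_2, …, m_r)`, the hypothesis on the
`a_i` says that `a_i = b q_i` for `i ≥ 2` and some integer `b`. Hence `ℂ^* × μ_d` acts on the last
coordinates `x_2, …, x_r` only through the scalars `s = ξ ^ b * t ^ g`, by `x_i ↦ s ^ q_i x_i`.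

On the curve the powers `x_i ^ m_i`, `i ≥ 2`, agree up to sign, so the last coordinates have the
form `s ^ q_i τ_i` with `τ_i ^ m_i = (-1) ^ i`. There are `∏ m_i` such vectors `τ`, and the
`N`-th roots of unity act on them freely because the `q_i` are coprime. Thus the curve is the union
of `∏ m_i / N` branches (`ReducedWeights.ncard_branches`), which meet only where the last
coordinates vanish, that is, in `A`. The branches are the irreducible components:

* a branch is closed (`ReducedWeights.isClosed_branch`), since a Bézout relation between the `q_i`
  turns the parametrization of the last coordinates into equations;
* a branch is irreducible (`ReducedWeights.isIrreducible_branch`). Its points with `s ≠ 0` are the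
  image of the affine curve `x ^ m_0 + y ^ m_1 + 1 = 0`, which is irreducible by Eisenstein's
  criterion, and the others are limits of these in the Euclidean topology.

The points of a branch on `{x_0 = 0}` are `[0 : y : τ]` with `y ^ m_1 = -1`. Two of them agree
exactly if the values of `y` differ by a value of the character `ξ ^ a_1 t ^ p_1` on the stabilizer
`ξ ^ b t ^ g = 1` of `τ`. This stabilizer consists of the pairs `ξ = ζ ^ (g Z)`,
`t = ζ ^ (d X - b Z)` with `ζ` a primitive root of unity of order `d g`, so these values are the
roots of unity of order `n = d g / gcd(d g, d p_1, a_1 g - p_1 b)`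
(`exists_stabilizer_iff_pow_eq_one`), and `y ↦ y ^ n` shows that there are `m_1 / n` points. The
hyperplane `{x_1 = 0}` is treated in the same way.
-/

noncomputable section

/-! ### Irreducible components of a finite union -/

theorem IsIrreducible.preimage_subtype_val {Y : Type*} [TopologicalSpace Y] {E C : Set Y}
    (hC : IsIrreducible C) (hCE : C ⊆ E) : IsIrreducible (Subtype.val ⁻¹' C : Set E) := by
  obtain ⟨⟨c, hc⟩, hpre⟩ := hC
  refine ⟨⟨⟨c, hCE hc⟩, hc⟩, ?_⟩
  rintro u v hu hv ⟨x, hxC, hxu⟩ ⟨y, hyC, hyv⟩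
  obtain ⟨U, hU, rfl⟩ := isOpen_induced_iff.1 hu
  obtain ⟨V, hV, rfl⟩ := isOpen_induced_iff.1 hv
  obtain ⟨z, hzC, hz⟩ := hpre U V hU hV ⟨x, hxC, hxu⟩ ⟨y, hyC, hyv⟩
  exact ⟨⟨z, hCE hzC⟩, hzC, hz⟩

theorem componentsOf_sUnion {Y : Type*} [TopologicalSpace Y] {𝒞 : Set (Set Y)}
    (hfin : 𝒞.Finite) (hcl : ∀ C ∈ 𝒞, IsClosed C) (hirr : ∀ C ∈ 𝒞, IsIrreducible C)
    (hanti : ∀ C ∈ 𝒞, ∀ C' ∈ 𝒞, C ⊆ C' → C = C') : componentsOf (⋃₀ 𝒞) = 𝒞 := by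
  have key : ∀ s : Set Y, s ⊆ ⋃₀ 𝒞 → IsIrreducible s → ∃ C ∈ 𝒞, s ⊆ C := by
    intro s hs hsi
    have := (isIrreducible_iff_sUnion_isClosed.1 hsi) hfin.toFinset
      (by simpa using hcl) (by simpa using hs)
    simpa using this
  have hsub : ∀ C ∈ 𝒞, C ⊆ ⋃₀ 𝒞 := fun C hC => Set.subset_sUnion_of_mem hC
  ext C
  constructor
  · rintro ⟨Z, hZ, rfl⟩
    have hZi : IsIrreducible (Subtype.val '' Z : Set Y) :=
      hZ.1.image _ continuous_subtype_val.continuousOn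
    obtain ⟨C, hC, hle⟩ := key _ (by rintro _ ⟨z, -, rfl⟩; exact z.2) hZi
    have hZC : Z ⊆ Subtype.val ⁻¹' C := fun z hz => hle ⟨z, hz, rfl⟩
    have : Z = Subtype.val ⁻¹' C := hZC.antisymm
      (hZ.2 ((hirr C hC).preimage_subtype_val (hsub C hC)) hZC)
    have himg : (Subtype.val '' Z : Set Y) = C := by
      rw [this, Subtype.image_preimage_coe, Set.inter_eq_right.2 (hsub C hC)]
    show Subtype.val '' Z ∈ 𝒞
    rwa [himg]
  · intro hC
    refine ⟨Subtype.val ⁻¹' C, ⟨(hirr C hC).preimage_subtype_val (hsub C hC), ?_⟩, ?_⟩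
    · intro Z hZ hCZ
      obtain ⟨C', hC', hle⟩ := key (Subtype.val '' Z) (by rintro _ ⟨z, -, rfl⟩; exact z.2)
        (hZ.image _ continuous_subtype_val.continuousOn)
      have : C = C' := hanti C hC C' hC' fun c hc =>
        hle ⟨⟨c, hsub C hC hc⟩, hCZ hc, rfl⟩
      subst this
      exact fun z hz => hle ⟨z, hz, rfl⟩
    · show Subtype.val '' (Subtype.val ⁻¹' C) = C
      rw [Subtype.image_preimage_coe, Set.inter_eq_right.2 (hsub C hC)]

/-! ### Roots of complex numbers -/

theorem Complex.card_nthRoots_toFinset {n : ℕ} (hn : 0 < n) {c : ℂ} (hc : c ≠ 0) :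
    (Polynomial.nthRoots n c).toFinset.card = n := by
  have hζ := Complex.isPrimitiveRoot_exp n hn.ne'
  rw [Multiset.toFinset_card_of_nodup (hζ.nthRoots_nodup hc), hζ.card_nthRoots,
    if_pos (IsAlgClosed.exists_pow_nat_eq c hn)]

theorem Complex.ncard_setOf_pow_eq {n : ℕ} (hn : 0 < n) {c : ℂ} (hc : c ≠ 0) :
    {y : ℂ | y ^ n = c}.Finite ∧ {y : ℂ | y ^ n = c}.ncard = n := by
  have h : {y : ℂ | y ^ n = c} = ((Polynomial.nthRoots n c).toFinset : Set ℂ) := by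
    ext y
    simp [Polynomial.mem_nthRoots hn]
  rw [h]
  exact ⟨Finset.finite_toSet _, by
    rw [Set.ncard_coe_finset, Complex.card_nthRoots_toFinset hn hc]⟩

/-! ### The affine Fermat curve -/

/-- The affine Fermat equation `X ^ n₀ + (Y ^ n₁ + 1)`, as a polynomial in `X` over `ℂ[Y]`. -/
def fermatCurve (n₀ n₁ : ℕ) : Polynomial (Polynomial ℂ) :=
  Polynomial.X ^ n₀ + Polynomial.C (Polynomial.X ^ n₁ + 1)

theorem fermatCurve_monic {n₀ : ℕ} (h₀ : 0 < n₀) (n₁ : ℕ) : (fermatCurve n₀ n₁).Monic :=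
  Polynomial.monic_X_pow_add_C _ h₀.ne'

theorem natDegree_fermatCurve (n₀ n₁ : ℕ) : (fermatCurve n₀ n₁).natDegree = n₀ :=
  Polynomial.natDegree_X_pow_add_C

theorem fermatCurve_evalEval_eq_zero {n₀ n₁ : ℕ} {x y : ℂ} (h : x ^ n₀ + y ^ n₁ + 1 = 0) :
    (fermatCurve n₀ n₁).evalEval y x = 0 := by
  simp [fermatCurve, Polynomial.evalEval, ← add_assoc, h]

/-- Eisenstein's criterion at a linear factor of `Y ^ n₁ + 1`, which is separable. -/
theorem fermatCurve_irreducible {n₀ n₁ : ℕ} (h₀ : 0 < n₀) (h₁ : 0 < n₁) :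
    Irreducible (fermatCurve n₀ n₁) := by
  obtain ⟨ρ, hρ⟩ := IsAlgClosed.exists_pow_nat_eq (-1 : ℂ) h₁
  have hρ0 : ρ ≠ 0 := by
    rintro rfl
    rw [zero_pow h₁.ne'] at hρ
    norm_num at hρ
  have hmon := fermatCurve_monic h₀ n₁
  have hprime : (Ideal.span {Polynomial.X - Polynomial.C ρ}).IsPrime :=
    (Ideal.span_singleton_prime (Polynomial.X_sub_C_ne_zero ρ)).2 (Polynomial.prime_X_sub_C ρ)
  have hcoeff : ∀ n < n₀, n ≠ 0 → (fermatCurve n₀ n₁).coeff n = 0 := by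
    intro n hn hn0
    rw [fermatCurve, Polynomial.coeff_add, Polynomial.coeff_C_of_ne_zero hn0,
      Polynomial.coeff_X_pow, if_neg hn.ne, add_zero]
  have hcoeff0 : (fermatCurve n₀ n₁).coeff 0 = Polynomial.X ^ n₁ + 1 := by
    rw [fermatCurve, Polynomial.coeff_add, Polynomial.coeff_C_zero, Polynomial.coeff_X_pow,
      if_neg h₀.ne, zero_add]
  refine Polynomial.irreducible_of_eisenstein_criterion hprime ?_ ?_ ?_ ?_ hmon.isPrimitive
  · rw [hmon.leadingCoeff]
    exact fun h => hprime.ne_top ((Ideal.eq_top_iff_one _).2 h)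
  · intro n hn
    rw [Polynomial.degree_eq_natDegree hmon.ne_zero, natDegree_fermatCurve] at hn
    rcases eq_or_ne n 0 with rfl | hn0
    · rw [hcoeff0, Ideal.mem_span_singleton, Polynomial.dvd_iff_isRoot]
      simp [hρ]
    · rw [hcoeff n (by exact_mod_cast hn) hn0]
      exact zero_mem _
  · rw [← Polynomial.natDegree_pos_iff_degree_pos, natDegree_fermatCurve]
    exact h₀
  · rw [hcoeff0, Ideal.span_singleton_pow, Ideal.mem_span_singleton]
    rintro ⟨f, hf⟩
    -- a double root would be a zero of the derivative
    have := congrArg (fun g => (Polynomial.derivative g).eval ρ) hf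
    simp [Polynomial.derivative_mul, Polynomial.derivative_pow, hρ0, h₁.ne'] at this

/-- A polynomial vanishing on the affine Fermat curve is a multiple of its equation: the remainder
modulo the equation has degree less than `n₀` in `X`, and `n₀` zeros over almost every `Y`. -/
theorem fermatCurve_dvd {n₀ n₁ : ℕ} (h₀ : 0 < n₀) (h₁ : 0 < n₁) {f : Polynomial (Polynomial ℂ)}
    (hf : ∀ x y : ℂ, x ^ n₀ + y ^ n₁ + 1 = 0 → f.evalEval y x = 0) : fermatCurve n₀ n₁ ∣ f := by
  have hmon := fermatCurve_monic h₀ n₁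
  rw [← Polynomial.modByMonic_eq_zero_iff_dvd hmon]
  set ρ := f %ₘ fermatCurve n₀ n₁ with hρ
  have hdeg : ρ.natDegree < n₀ := by
    have := Polynomial.natDegree_modByMonic_lt f hmon (by
      intro h
      have := natDegree_fermatCurve n₀ n₁
      rw [h, Polynomial.natDegree_one] at this
      omega)
    rwa [natDegree_fermatCurve] at this
  have hvan : ∀ x y : ℂ, x ^ n₀ + y ^ n₁ + 1 = 0 → ρ.evalEval y x = 0 := by
    intro x y hxy
    have h := congrArg (Polynomial.evalEval y x)
      (Polynomial.modByMonic_add_div f (fermatCurve n₀ n₁))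
    rw [Polynomial.evalEval_add, Polynomial.evalEval_mul, hf x y hxy] at h
    rwa [fermatCurve_evalEval_eq_zero hxy, zero_mul, add_zero] at h
  have hmap : ∀ y : ℂ, y ^ n₁ + 1 ≠ 0 → ρ.map (Polynomial.evalRingHom y) = 0 := by
    intro y hy
    refine Polynomial.eq_zero_of_natDegree_lt_card_of_eval_eq_zero' _
      (Polynomial.nthRoots n₀ (-(y ^ n₁ + 1))).toFinset ?_ ?_
    · intro x hx
      rw [Multiset.mem_toFinset, Polynomial.mem_nthRoots h₀] at hx
      rw [Polynomial.map_evalRingHom_eval]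
      exact hvan x y (by rw [hx]; ring)
    · rw [Complex.card_nthRoots_toFinset h₀ (neg_ne_zero.2 hy)]
      exact Polynomial.natDegree_map_le.trans_lt hdeg
  ext1 j
  have hprod : ρ.coeff j * (Polynomial.X ^ n₁ + 1) = 0 := by
    refine Polynomial.funext fun y => ?_
    by_cases hy : y ^ n₁ + 1 = 0
    · simp [hy]
    · have := congrArg (fun g => g.coeff j) (hmap y hy)
      simp only [Polynomial.coeff_map, Polynomial.coe_evalRingHom, Polynomial.coeff_zero] at this
      simp [this]
  have hne : (Polynomial.X ^ n₁ + 1 : Polynomial ℂ) ≠ 0 :=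
    (Polynomial.monic_X_pow_add_C (1 : ℂ) h₁.ne').ne_zero
  simpa [hne] using hprod

theorem fermatCurve_vanish_of_mul {n₀ n₁ : ℕ} (h₀ : 0 < n₀) (h₁ : 0 < n₁)
    {f g : Polynomial (Polynomial ℂ)}
    (hfg : ∀ x y : ℂ, x ^ n₀ + y ^ n₁ + 1 = 0 → f.evalEval y x = 0 ∨ g.evalEval y x = 0) :
    (∀ x y : ℂ, x ^ n₀ + y ^ n₁ + 1 = 0 → f.evalEval y x = 0) ∨
      ∀ x y : ℂ, x ^ n₀ + y ^ n₁ + 1 = 0 → g.evalEval y x = 0 := by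
  have hvan : ∀ h : Polynomial (Polynomial ℂ), fermatCurve n₀ n₁ ∣ h →
      ∀ x y : ℂ, x ^ n₀ + y ^ n₁ + 1 = 0 → h.evalEval y x = 0 := by
    rintro _ ⟨h, rfl⟩ x y hxy
    rw [Polynomial.evalEval_mul]
    rw [fermatCurve_evalEval_eq_zero hxy, zero_mul]
  have hdvd : fermatCurve n₀ n₁ ∣ f * g := fermatCurve_dvd h₀ h₁ fun x y hxy => by
    rw [Polynomial.evalEval_mul, mul_eq_zero]
    exact hfg x y hxy
  exact ((fermatCurve_irreducible h₀ h₁).prime.dvd_or_dvd hdvd).imp (hvan f) (hvan g)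

/-! ### The cone over the system of equations -/

theorem mem_tailIdx {r : ℕ} {i : Fin (r + 1)} : i ∈ tailIdx r ↔ 2 ≤ i.val := by
  simp [tailIdx]

theorem Fin.val_two_of_le {r : ℕ} (hr : 2 ≤ r) : ((2 : Fin (r + 1)) : ℕ) = 2 := by
  change 2 % (r + 1) = 2
  exact Nat.mod_eq_of_lt (by omega)

theorem Fin.val_one_of_le {r : ℕ} (hr : 2 ≤ r) : ((1 : Fin (r + 1)) : ℕ) = 1 := by
  change 1 % (r + 1) = 1
  exact Nat.mod_eq_of_lt (by omega)

theorem two_mem_tailIdx {r : ℕ} (hr : 2 ≤ r) : (2 : Fin (r + 1)) ∈ tailIdx r := by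
  rw [mem_tailIdx, Fin.val_two_of_le hr]

theorem zero_notMem_tailIdx (r : ℕ) : (0 : Fin (r + 1)) ∉ tailIdx r := by
  simp [mem_tailIdx]

theorem one_notMem_tailIdx {r : ℕ} (hr : 2 ≤ r) : (1 : Fin (r + 1)) ∉ tailIdx r := by
  rw [mem_tailIdx, Fin.val_one_of_le hr]
  norm_num

theorem Fin.eq_zero_or_eq_one_of_notMem_tailIdx {r : ℕ} (hr : 2 ≤ r) {i : Fin (r + 1)}
    (hi : i ∉ tailIdx r) : i = 0 ∨ i = 1 := by
  rw [mem_tailIdx, not_le] at hi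
  have h1 := Fin.val_one_of_le hr
  rcases Nat.lt_or_ge i.val 1 with h | h
  · exact Or.inl (Fin.ext (by simpa using h))
  · exact Or.inr (Fin.ext (by omega))

/-- On the zero set of the system, the powers `x_i ^ m_i` with `i ≥ 2` agree up to alternating
signs. -/
theorem forall_fermatSystem_eval_eq_zero_iff {r : ℕ} (hr : 2 ≤ r) (m : Fin (r + 1) → ℕ)
    (x : Fin (r + 1) → ℂ) :
    (∀ f ∈ fermatSystem r m, eval x f = 0) ↔
      ∃ e : ℂ, x 0 ^ m 0 + x 1 ^ m 1 + e = 0 ∧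
        ∀ i ∈ tailIdx r, x i ^ m i = (-1) ^ i.val * e := by
  constructor
  · intro h
    refine ⟨x 2 ^ m 2, ?_, ?_⟩
    · simpa using h _ (Or.inl rfl)
    · have key : ∀ n, ∀ hn : n + 2 < r + 1, x ⟨n + 2, hn⟩ ^ m ⟨n + 2, hn⟩ =
          (-1) ^ (n + 2) * x 2 ^ m 2 := by
        intro n
        induction n with
        | zero =>
          intro hn
          have : (⟨0 + 2, hn⟩ : Fin (r + 1)) = 2 := Fin.ext (Fin.val_two_of_le hr).symm
          rw [this]
          norm_num
        | succ n ih =>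
          intro hn
          have := h _ (Or.inr ⟨⟨n + 2, by omega⟩, ⟨n + 1 + 2, hn⟩, by simp, by simp, rfl⟩)
          simp only [map_add, map_pow, eval_X] at this
          rw [ih] at this
          rw [eq_neg_of_add_eq_zero_right this]
          ring
      intro i hi
      rw [mem_tailIdx] at hi
      have := key (i.val - 2) (by omega)
      have hi' : (⟨i.val - 2 + 2, by omega⟩ : Fin (r + 1)) = i := Fin.ext (by simp; omega)
      rw [hi', Nat.sub_add_cancel hi] at this
      exact this
  · rintro ⟨e, h0, h⟩ f (rfl | ⟨i, j, hi, hj, rfl⟩)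
    · have h2 := h 2 (two_mem_tailIdx hr)
      rw [Fin.val_two_of_le hr] at h2
      simp only [map_add, map_pow, eval_X, h2]
      rw [← h0]
      ring
    · simp only [map_add, map_pow, eval_X]
      rw [h i (mem_tailIdx.2 hi), h j (mem_tailIdx.2 (by omega)), hj]
      ring

theorem weight_mul_eq_of_isWeightedHomogeneous {σ : Type*} {p m : σ → ℕ}
    {f : MvPolynomial σ ℂ} {k : ℕ} (hf : IsWeightedHomogeneous p f k) {i : σ}
    (hi : coeff (Finsupp.single i (m i)) f ≠ 0) : p i * m i = k := by
  have := hf hi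
  rw [Finsupp.weight_apply, Finsupp.sum_single_index (by simp)] at this
  rw [← this, smul_eq_mul, mul_comm]

theorem coeff_single_X_pow {σ : Type*} [DecidableEq σ] {m : σ → ℕ} (hm : ∀ i, 0 < m i) (i j : σ) :
    coeff (Finsupp.single i (m i)) (X j ^ m j : MvPolynomial σ ℂ) = if j = i then 1 else 0 := by
  rw [coeff_X_pow]
  congr 1
  rw [Finsupp.single_eq_single_iff]
  have := hm i
  have := hm j
  apply propext
  constructor
  · rintro (h | h)
    · exact h.1
    · omega
  · rintro rfl
    exact Or.inl ⟨rfl, rfl⟩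

/-- Homogeneity of the equations makes all the products `p_i m_i` equal. -/
theorem exists_weight_mul_eq {r : ℕ} (hr : 2 ≤ r) {p m : Fin (r + 1) → ℕ} (hm : ∀ i, 0 < m i)
    (hhom : ∀ f ∈ fermatSystem r m, ∃ k : ℕ, IsWeightedHomogeneous p f k) :
    ∃ k, ∀ i, p i * m i = k := by
  have hv1 := Fin.val_one_of_le hr
  have hv2 := Fin.val_two_of_le hr
  have h01 : (0 : Fin (r + 1)) ≠ 1 := Fin.ne_of_val_ne (by rw [hv1, Fin.val_zero]; norm_num)
  have h02 : (0 : Fin (r + 1)) ≠ 2 := Fin.ne_of_val_ne (by rw [hv2, Fin.val_zero]; norm_num)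
  have h12 : (1 : Fin (r + 1)) ≠ 2 := Fin.ne_of_val_ne (by rw [hv1, hv2]; norm_num)
  obtain ⟨k, hk⟩ := hhom _ (Or.inl rfl)
  have hk0 : p 0 * m 0 = k := weight_mul_eq_of_isWeightedHomogeneous hk (by
    simp [coeff_single_X_pow hm, h01.symm, h02.symm])
  have hk1 : p 1 * m 1 = k := weight_mul_eq_of_isWeightedHomogeneous hk (by
    simp [coeff_single_X_pow hm, h01, h12.symm])
  have hk2 : p 2 * m 2 = k := weight_mul_eq_of_isWeightedHomogeneous hk (by
    simp [coeff_single_X_pow hm, h02, h12])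
  refine ⟨k, ?_⟩
  have key : ∀ n, ∀ hn : n + 2 < r + 1, p ⟨n + 2, hn⟩ * m ⟨n + 2, hn⟩ = k := by
    intro n
    induction n with
    | zero =>
      intro hn
      have : (⟨0 + 2, hn⟩ : Fin (r + 1)) = 2 := Fin.ext (Fin.val_two_of_le hr).symm
      rw [this, hk2]
    | succ n ih =>
      intro hn
      have hne : (⟨n + 2, by omega⟩ : Fin (r + 1)) ≠ ⟨n + 1 + 2, hn⟩ := fun h => by
        simpa using congrArg Fin.val h
      obtain ⟨l, hl⟩ := hhom _
        (Or.inr ⟨⟨n + 2, by omega⟩, ⟨n + 1 + 2, hn⟩, by simp, by simp, rfl⟩)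
      have hl1 : p ⟨n + 2, by omega⟩ * m ⟨n + 2, by omega⟩ = l :=
        weight_mul_eq_of_isWeightedHomogeneous hl (by
          rw [coeff_add, coeff_single_X_pow hm, coeff_single_X_pow hm, if_pos rfl, if_neg hne.symm]
          simp)
      have hl2 : p ⟨n + 1 + 2, hn⟩ * m ⟨n + 1 + 2, hn⟩ = l :=
        weight_mul_eq_of_isWeightedHomogeneous hl (by
          rw [coeff_add, coeff_single_X_pow hm, coeff_single_X_pow hm, if_pos rfl, if_neg hne]
          simp)
      rw [hl2, ← hl1, ih]
  intro i
  by_cases hi : i ∈ tailIdx r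
  · rw [mem_tailIdx] at hi
    have hi' : (⟨i.val - 2 + 2, by omega⟩ : Fin (r + 1)) = i := Fin.ext (by simp; omega)
    have := key (i.val - 2) (by omega)
    rwa [hi'] at this
  · rcases Fin.eq_zero_or_eq_one_of_notMem_tailIdx hr hi with rfl | rfl
    · exact hk0
    · exact hk1

/-! ### Arithmetic of the weights -/

/-- The arithmetic of the weights: `g` is the greatest common divisor of `p_2, …, p_r`, the `q_i`
are the reduced weights `p_i / g`, which satisfy the Bézout relation `∑ (u_i - v_i) q_i = 1`
with natural numbers `u_i`, `v_i`, `b` is the common ratio `a_i / q_i`, and `N` the common value of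
`q_i m_i`. -/
structure ReducedWeights (r d : ℕ) (p m : Fin (r + 1) → ℕ) (a : Fin (r + 1) → ℤ)
    (g N : ℕ) (b : ℤ) (q u v : Fin (r + 1) → ℕ) : Prop where
  two_le : 2 ≤ r
  d_pos : 0 < d
  m_pos : ∀ i, 0 < m i
  g_pos : 0 < g
  N_pos : 0 < N
  p_eq : ∀ i ∈ tailIdx r, p i = g * q i
  a_eq : ∀ i ∈ tailIdx r, a i = b * q i
  q_mul_m : ∀ i ∈ tailIdx r, q i * m i = N
  p_mul_m : ∀ i, p i * m i = g * N
  dvd_a_mul_m : ∀ i, (d : ℤ) ∣ a i * m i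
  bezout : ∑ i ∈ tailIdx r, u i * q i = 1 + ∑ i ∈ tailIdx r, v i * q i

theorem exists_bezout {ι : Type*} {s : Finset ι} {q : ι → ℕ} (h : s.gcd q = 1) :
    ∃ u v : ι → ℕ, ∑ i ∈ s, u i * q i = 1 + ∑ i ∈ s, v i * q i := by
  obtain ⟨w, hw⟩ := Finset.gcd_eq_sum_mul s fun i => (q i : ℤ)
  have h1 : (s.gcd fun i => (q i : ℤ)) = 1 := by
    have hunit : IsUnit (s.gcd fun i => (q i : ℤ)) := by
      rw [Int.isUnit_iff_natAbs_eq, ← Nat.dvd_one, ← h]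
      exact Finset.dvd_gcd fun i hi => Int.natAbs_dvd_natAbs.2 (Finset.gcd_dvd hi)
    rw [← Finset.normalize_gcd, normalize_eq_one.2 hunit]
  refine ⟨fun i => (w i).toNat, fun i => (-w i).toNat, ?_⟩
  zify
  rw [← h1, hw, ← Finset.sum_add_distrib]
  refine Finset.sum_congr rfl fun i _ => ?_
  have : ((w i).toNat : ℤ) - ((-w i).toNat : ℤ) = w i := Int.toNat_sub_toNat_neg _
  linear_combination (q i : ℤ) * this

theorem exists_reducedWeights {r d : ℕ} (hr : 2 ≤ r) (hd : 0 < d) {p m : Fin (r + 1) → ℕ}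
    {a : Fin (r + 1) → ℤ} (hp : ∀ i, 0 < p i) (hm : ∀ i, 0 < m i)
    (hdvd : ∀ i, (d : ℤ) ∣ a i * (m i : ℤ))
    (hhom : ∀ f ∈ fermatSystem r m, ∃ k : ℕ, IsWeightedHomogeneous p f k)
    (hap : ∀ i ∈ tailIdx r, ∀ j ∈ tailIdx r, a i * (p j : ℤ) - a j * (p i : ℤ) = 0) :
    ∃ N b q u v, ReducedWeights r d p m a ((tailIdx r).gcd p) N b q u v := by
  obtain ⟨k, hk⟩ := exists_weight_mul_eq hr hm hhom
  have h2 := two_mem_tailIdx hr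
  obtain ⟨q, hq, hq1⟩ := Finset.extract_gcd p ⟨2, h2⟩
  set g := (tailIdx r).gcd p with hg
  have hg0 : 0 < g := Nat.pos_of_ne_zero fun h => by
    have := hq 2 h2
    rw [h, zero_mul] at this
    exact (hp 2).ne' this
  obtain ⟨u, v, huv⟩ := exists_bezout hq1
  have hqm : ∀ i ∈ tailIdx r, ∀ j ∈ tailIdx r, q i * m i = q j * m j := by
    intro i hi j hj
    apply Nat.eq_of_mul_eq_mul_left hg0
    rw [← mul_assoc, ← mul_assoc, ← hq i hi, ← hq j hj, hk, hk]
  have haq : ∀ i ∈ tailIdx r, ∀ j ∈ tailIdx r, a i * (q j : ℤ) = a j * q i := by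
    intro i hi j hj
    have := hap i hi j hj
    rw [hq i hi, hq j hj] at this
    push_cast at this
    have hg0' : (g : ℤ) ≠ 0 := by exact_mod_cast hg0.ne'
    apply mul_left_cancel₀ hg0'
    linear_combination this
  have hN : 0 < q 2 * m 2 := by
    refine Nat.mul_pos (Nat.pos_of_ne_zero fun h => ?_) (hm 2)
    have := hq 2 h2
    rw [h, mul_zero] at this
    exact (hp 2).ne' this
  refine ⟨q 2 * m 2, ∑ i ∈ tailIdx r, (u i - v i) * a i, q, u, v,
    hr, hd, hm, hg0, hN, hq, ?_, fun i hi => hqm i hi 2 h2, ?_, hdvd, huv⟩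
  · intro i hi
    -- the Bézout coefficients also express the common ratio of `a_i` and `q_i`
    have h1 : (∑ j ∈ tailIdx r, ((u j : ℤ) - v j) * q j) = 1 := by
      have : ((∑ j ∈ tailIdx r, u j * q j : ℕ) : ℤ) = ((1 + ∑ j ∈ tailIdx r, v j * q j : ℕ) : ℤ) :=
        congrArg _ huv
      push_cast at this
      simp only [sub_mul, Finset.sum_sub_distrib]
      linarith
    rw [Finset.sum_mul]
    calc a i = a i * ∑ j ∈ tailIdx r, ((u j : ℤ) - v j) * q j := by rw [h1, mul_one]
      _ = _ := by
        rw [Finset.mul_sum]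
        refine Finset.sum_congr rfl fun j hj => ?_
        linear_combination ((u j : ℤ) - v j) * haq i hi j hj
  · intro i
    rw [← mul_assoc, ← hq 2 h2, hk, hk]

namespace ReducedWeights

variable {r d : ℕ} {p m : Fin (r + 1) → ℕ} {a : Fin (r + 1) → ℤ}
  {g N : ℕ} {b : ℤ} {q u v : Fin (r + 1) → ℕ}

theorem q_pos (R : ReducedWeights r d p m a g N b q u v) {i : Fin (r + 1)} (hi : i ∈ tailIdx r) :
    0 < q i :=
  Nat.pos_of_mul_pos_right (by rw [R.q_mul_m i hi]; exact R.N_pos)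

theorem eq_lcm (R : ReducedWeights r d p m a g N b q u v) : N = (tailIdx r).lcm m := by
  apply Nat.dvd_antisymm
  · have h : ∀ w : Fin (r + 1) → ℕ, N ∣ (∑ i ∈ tailIdx r, w i * q i) * (tailIdx r).lcm m := by
      intro w
      rw [Finset.sum_mul]
      refine Finset.dvd_sum fun i hi => ?_
      rw [mul_assoc, ← R.q_mul_m i hi]
      exact Dvd.dvd.mul_left (Nat.mul_dvd_mul_left _ (Finset.dvd_lcm hi)) _
    have h1 := h u
    rw [R.bezout, add_mul, one_mul] at h1
    exact (Nat.dvd_add_left (h v)).1 h1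
  · exact Finset.lcm_dvd fun i hi => ⟨q i, by rw [← R.q_mul_m i hi, mul_comm]⟩

/-- As the reduced weights are coprime, `s` is determined by the powers `s ^ q_i`. -/
theorem pow_injective (R : ReducedWeights r d p m a g N b q u v) {s t : ℂ} (ht : t ≠ 0)
    (h : ∀ i ∈ tailIdx r, s ^ q i = t ^ q i) : s = t := by
  have hw : ∀ w : Fin (r + 1) → ℕ,
      s ^ (∑ i ∈ tailIdx r, w i * q i) = t ^ (∑ i ∈ tailIdx r, w i * q i) := by
    intro w
    rw [← Finset.prod_pow_eq_pow_sum, ← Finset.prod_pow_eq_pow_sum]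
    refine Finset.prod_congr rfl fun i hi => ?_
    rw [mul_comm, pow_mul, pow_mul, h i hi]
  have h1 := hw u
  rw [R.bezout, pow_add, pow_add, hw v, pow_one, pow_one] at h1
  exact mul_right_cancel₀ (pow_ne_zero _ ht) h1

end ReducedWeights

/-! ### The branches of the curve -/

/-- The vectors `τ` with `τ_i ^ m_i = (-1) ^ i` for `i ≥ 2` and `τ_0 = τ_1 = 0`. Up to a weighted
scalar they describe the possible last coordinates `x_2, …, x_r` of a point of the curve. -/
def twists {r : ℕ} (m : Fin (r + 1) → ℕ) : Finset (Fin (r + 1) → ℂ) :=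
  Fintype.piFinset fun i =>
    if i ∈ tailIdx r then (Polynomial.nthRoots (m i) ((-1 : ℂ) ^ i.val)).toFinset else {0}

/-- The cone over the branch of the curve belonging to `τ`: the last coordinates are
`s ^ q_i * τ_i` for some scalar `s`, which may be zero. -/
def branchCone {r : ℕ} (m q : Fin (r + 1) → ℕ) (N : ℕ) (τ : Fin (r + 1) → ℂ) :
    Set (PuncturedSpace r) :=
  {x | ∃ s : ℂ, x.1 0 ^ m 0 + x.1 1 ^ m 1 + s ^ N = 0 ∧ ∀ i ∈ tailIdx r, x.1 i = s ^ q i * τ i}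

/-- The branch of the curve belonging to `τ`. -/
def branch {r : ℕ} (d : ℕ) (p : Fin (r + 1) → ℕ) (a : Fin (r + 1) → ℤ) (m q : Fin (r + 1) → ℕ)
    (N : ℕ) (τ : Fin (r + 1) → ℂ) : Set (WeightedProjQuot r d p a) :=
  WeightedProjQuot.mk '' branchCone m q N τ

/-- The vector `(x, y, τ_2, …, τ_r)`. -/
def joinTail {r : ℕ} {K : Type*} (x y : K) (τ : Fin (r + 1) → K) : Fin (r + 1) → K :=
  fun i => if i = 0 then x else if i = 1 then y else τ i

theorem joinTail_zero {r : ℕ} {K : Type*} (x y : K) (τ : Fin (r + 1) → K) :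
    joinTail x y τ 0 = x := by
  simp [joinTail]

theorem joinTail_one {r : ℕ} {K : Type*} (hr : 2 ≤ r) (x y : K) (τ : Fin (r + 1) → K) :
    joinTail x y τ 1 = y := by
  have : (1 : Fin (r + 1)) ≠ 0 :=
    Fin.ne_of_val_ne (by rw [Fin.val_one_of_le hr, Fin.val_zero]; norm_num)
  simp [joinTail, this]

theorem joinTail_tail {r : ℕ} {K : Type*} (hr : 2 ≤ r) (x y : K) (τ : Fin (r + 1) → K)
    {i : Fin (r + 1)} (hi : i ∈ tailIdx r) : joinTail x y τ i = τ i := by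
  have h0 : i ≠ 0 := fun h => zero_notMem_tailIdx r (h ▸ hi)
  have h1 : i ≠ 1 := fun h => one_notMem_tailIdx hr (h ▸ hi)
  simp [joinTail, h0, h1]

theorem WeightedProjQuot.mk_eq_mk_iff {r d : ℕ} {p : Fin (r + 1) → ℕ} {a : Fin (r + 1) → ℤ}
    {x y : PuncturedSpace r} :
    (WeightedProjQuot.mk x : WeightedProjQuot r d p a) = WeightedProjQuot.mk y ↔
      ∃ t : ℂˣ, ∃ ξ ∈ rootsOfUnity d ℂ, ∀ i, y.1 i = ((ξ ^ a i * t ^ p i : ℂˣ) : ℂ) * x.1 i :=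
  Quotient.eq (r := weightedSetoid r d p a)

theorem WeightedProjQuot.mk_mem_hyperplane_iff {r d : ℕ} {p : Fin (r + 1) → ℕ}
    {a : Fin (r + 1) → ℤ} {x : PuncturedSpace r} {i : Fin (r + 1)} :
    (WeightedProjQuot.mk x : WeightedProjQuot r d p a) ∈ WeightedProjQuot.hyperplane i ↔
      x.1 i = 0 := by
  constructor
  · rintro ⟨y, hy, h⟩
    obtain ⟨t, ξ, -, h⟩ := WeightedProjQuot.mk_eq_mk_iff.1 h
    have hy0 : y.1 i = 0 := by simpa using hy
    rw [h i, hy0, mul_zero]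
  · intro h
    exact ⟨x, by simpa using h, rfl⟩

namespace ReducedWeights

variable {r d : ℕ} {p m : Fin (r + 1) → ℕ} {a : Fin (r + 1) → ℤ}
  {g N : ℕ} {b : ℤ} {q u v : Fin (r + 1) → ℕ}

theorem mem_twists_iff (R : ReducedWeights r d p m a g N b q u v) {τ : Fin (r + 1) → ℂ} :
    τ ∈ twists m ↔
      (∀ i ∈ tailIdx r, τ i ^ m i = (-1) ^ i.val) ∧ ∀ i ∉ tailIdx r, τ i = 0 := by
  rw [twists, Fintype.mem_piFinset, ← forall_and]
  refine forall_congr' fun i => ?_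
  by_cases hi : i ∈ tailIdx r
  · simp [hi, Polynomial.mem_nthRoots (R.m_pos i)]
  · simp [hi]

theorem card_twists (R : ReducedWeights r d p m a g N b q u v) :
    (twists m).card = ∏ i ∈ tailIdx r, m i := by
  rw [twists, Fintype.card_piFinset, ← Finset.prod_subset (Finset.subset_univ (tailIdx r))
    fun i _ hi => by rw [if_neg hi, Finset.card_singleton]]
  refine Finset.prod_congr rfl fun i hi => ?_
  rw [if_pos hi, Complex.card_nthRoots_toFinset (R.m_pos i) (by simp)]

theorem twist_ne_zero (R : ReducedWeights r d p m a g N b q u v) {τ : Fin (r + 1) → ℂ}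
    (hτ : τ ∈ twists m) {i : Fin (r + 1)} (hi : i ∈ tailIdx r) : τ i ≠ 0 := by
  intro h
  have := (R.mem_twists_iff.1 hτ).1 i hi
  rw [h, zero_pow (R.m_pos i).ne'] at this
  exact pow_ne_zero i.val (neg_ne_zero.2 one_ne_zero) this.symm

/-- On the last coordinates the group `ℂ^* × μ_d` acts through the scalars `ξ ^ b * t ^ g`. -/
theorem scalar_eq_pow (R : ReducedWeights r d p m a g N b q u v) (t ξ : ℂˣ) {i : Fin (r + 1)}
    (hi : i ∈ tailIdx r) : ξ ^ a i * t ^ p i = (ξ ^ b * t ^ g) ^ q i := by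
  rw [R.a_eq i hi, R.p_eq i hi, mul_pow, zpow_mul, zpow_natCast, pow_mul]

theorem scalar_pow_m (R : ReducedWeights r d p m a g N b q u v) (t : ℂˣ) {ξ : ℂˣ}
    (hξ : ξ ∈ rootsOfUnity d ℂ) (i : Fin (r + 1)) :
    (ξ ^ a i * t ^ p i) ^ m i = t ^ (g * N) := by
  obtain ⟨c, hc⟩ := R.dvd_a_mul_m i
  rw [mem_rootsOfUnity] at hξ
  rw [mul_pow, ← zpow_natCast (ξ ^ a i), ← zpow_mul, hc, zpow_mul, zpow_natCast, hξ, one_zpow,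
    one_mul, ← pow_mul, R.p_mul_m]

theorem scalar_pow_N (R : ReducedWeights r d p m a g N b q u v) (t : ℂˣ) {ξ : ℂˣ}
    (hξ : ξ ∈ rootsOfUnity d ℂ) : (ξ ^ b * t ^ g) ^ N = t ^ (g * N) := by
  have h2 := two_mem_tailIdx R.two_le
  rw [← R.scalar_pow_m t hξ 2, R.scalar_eq_pow t ξ h2, ← pow_mul, R.q_mul_m 2 h2]

theorem mk_mem_branch_iff (R : ReducedWeights r d p m a g N b q u v) {τ : Fin (r + 1) → ℂ}
    {x : PuncturedSpace r} : WeightedProjQuot.mk x ∈ branch d p a m q N τ ↔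
      x ∈ branchCone m q N τ := by
  refine ⟨?_, fun h => ⟨x, h, rfl⟩⟩
  rintro ⟨y, ⟨s, h0, hs⟩, h⟩
  obtain ⟨t, ξ, hξ, h⟩ := WeightedProjQuot.mk_eq_mk_iff.1 h
  refine ⟨((ξ ^ b * t ^ g : ℂˣ) : ℂ) * s, ?_, fun i hi => ?_⟩
  · rw [h 0, h 1, mul_pow, mul_pow, mul_pow, ← Units.val_pow_eq_pow_val, ← Units.val_pow_eq_pow_val,
      ← Units.val_pow_eq_pow_val, R.scalar_pow_m t hξ, R.scalar_pow_m t hξ, R.scalar_pow_N t hξ,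
      ← mul_add, ← mul_add, h0, mul_zero]
  · rw [h i, hs i hi, R.scalar_eq_pow t ξ hi, mul_pow _ s, Units.val_pow_eq_pow_val, mul_assoc]

/-- The cone over the curve is the union of the cones over its branches. -/
theorem forall_eval_eq_zero_iff_exists_branchCone (R : ReducedWeights r d p m a g N b q u v)
    {x : PuncturedSpace r} :
    (∀ f ∈ fermatSystem r m, eval x.1 f = 0) ↔ ∃ τ ∈ twists m, x ∈ branchCone m q N τ := by
  rw [forall_fermatSystem_eval_eq_zero_iff R.two_le]
  constructor
  · rintro ⟨e, h0, he⟩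
    obtain ⟨s, rfl⟩ := IsAlgClosed.exists_pow_nat_eq e R.N_pos
    by_cases hs : s = 0
    · subst hs
      have hne : (twists m).Nonempty := Finset.card_pos.1 (by
        rw [R.card_twists]
        exact Finset.prod_pos fun i _ => R.m_pos i)
      obtain ⟨τ, hτ⟩ := hne
      refine ⟨τ, hτ, 0, h0, fun i hi => ?_⟩
      have := he i hi
      rw [zero_pow R.N_pos.ne', mul_zero, pow_eq_zero_iff (R.m_pos i).ne'] at this
      rw [this, zero_pow (R.q_pos hi).ne', zero_mul]
    · refine ⟨fun i => if i ∈ tailIdx r then x.1 i / s ^ q i else 0, R.mem_twists_iff.2 ⟨?_, ?_⟩,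
        s, h0, fun i hi => ?_⟩
      · intro i hi
        rw [if_pos hi, div_pow, he i hi, ← pow_mul, R.q_mul_m i hi,
          mul_div_cancel_right₀ _ (pow_ne_zero _ hs)]
      · intro i hi
        rw [if_neg hi]
      · dsimp only
        rw [if_pos hi, mul_div_cancel₀ _ (pow_ne_zero _ hs)]
  · rintro ⟨τ, hτ, s, h0, hs⟩
    refine ⟨s ^ N, h0, fun i hi => ?_⟩
    rw [hs i hi, mul_pow, ← pow_mul, R.q_mul_m i hi, (R.mem_twists_iff.1 hτ).1 i hi, mul_comm]

theorem zeroSet_fermatSystem (R : ReducedWeights r d p m a g N b q u v) :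
    (WeightedProjQuot.zeroSet (fermatSystem r m) : Set (WeightedProjQuot r d p a)) =
      ⋃₀ (branch d p a m q N '' (twists m : Set (Fin (r + 1) → ℂ))) := by
  ext z
  constructor
  · rintro ⟨x, hx, rfl⟩
    obtain ⟨τ, hτ, hxτ⟩ := R.forall_eval_eq_zero_iff_exists_branchCone.1 hx
    exact ⟨_, ⟨τ, hτ, rfl⟩, x, hxτ, rfl⟩
  · rintro ⟨_, ⟨τ, hτ, rfl⟩, x, hxτ, rfl⟩
    exact ⟨x, R.forall_eval_eq_zero_iff_exists_branchCone.2 ⟨τ, hτ, hxτ⟩, rfl⟩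

/-- The monomial `∏ (x_j / τ_j) ^ w_j` in the last coordinates. -/
def tailMonomial {r : ℕ} (τ : Fin (r + 1) → ℂ) (w : Fin (r + 1) → ℕ) :
    MvPolynomial (Fin (r + 1)) ℂ :=
  ∏ j ∈ tailIdx r, (C (τ j)⁻¹ * X j) ^ w j

theorem eval_tailMonomial (x τ : Fin (r + 1) → ℂ) (w : Fin (r + 1) → ℕ) :
    eval x (tailMonomial τ w) = ∏ j ∈ tailIdx r, ((τ j)⁻¹ * x j) ^ w j := by
  simp [tailMonomial, map_prod]

/-- Besides the equations of the curve, the cone of a branch satisfies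
`(x_i / τ_i) V ^ q_i = U ^ q_i`, where `U` and `V` are the monomials with the Bézout exponents.
Conversely, where the last coordinates do not vanish, these equations force
`x_i / τ_i = (U / V) ^ q_i`. -/
theorem isClosed_branch (R : ReducedWeights r d p m a g N b q u v) {τ : Fin (r + 1) → ℂ}
    (hτ : τ ∈ twists m) : IsClosed (branch d p a m q N τ) := by
  rw [WeightedProjQuot.isClosed_iff]
  refine ⟨fermatSystem r m ∪ {f | ∃ i ∈ tailIdx r, f =
    C (τ i)⁻¹ * X i * tailMonomial τ v ^ q i - tailMonomial τ u ^ q i}, fun x => ?_⟩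
  rw [R.mk_mem_branch_iff]
  constructor
  · intro hx f hf
    rcases hf with hf | ⟨i, hi, rfl⟩
    · exact R.forall_eval_eq_zero_iff_exists_branchCone.2 ⟨τ, hτ, hx⟩ f hf
    · obtain ⟨s, -, hs⟩ := hx
      have hq : ∀ j ∈ tailIdx r, (τ j)⁻¹ * x.1 j = s ^ q j := fun j hj => by
        rw [hs j hj, mul_comm, mul_assoc, mul_inv_cancel₀ (R.twist_ne_zero hτ hj), mul_one]
      have hw : ∀ w : Fin (r + 1) → ℕ,
          eval x.1 (tailMonomial τ w) = s ^ ∑ j ∈ tailIdx r, w j * q j := fun w => by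
        rw [eval_tailMonomial, ← Finset.prod_pow_eq_pow_sum]
        refine Finset.prod_congr rfl fun j hj => ?_
        rw [hq j hj, ← pow_mul, mul_comm]
      simp only [map_sub, map_mul, map_pow, eval_C, eval_X, hw]
      rw [hq i hi, R.bezout, pow_add, mul_pow, pow_one, sub_self]
  · intro h
    obtain ⟨e, h0, he⟩ := (forall_fermatSystem_eval_eq_zero_iff R.two_le m x.1).1
      fun f hf => h f (Or.inl hf)
    by_cases he0 : e = 0
    · subst he0
      refine ⟨0, by rwa [zero_pow R.N_pos.ne'], fun i hi => ?_⟩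
      have := he i hi
      rw [mul_zero, pow_eq_zero_iff (R.m_pos i).ne'] at this
      rw [this, zero_pow (R.q_pos hi).ne', zero_mul]
    · have hx : ∀ i ∈ tailIdx r, x.1 i ≠ 0 := fun i hi hxi => by
        have := he i hi
        rw [hxi, zero_pow (R.m_pos i).ne'] at this
        exact mul_ne_zero (pow_ne_zero i.val (neg_ne_zero.2 one_ne_zero)) he0 this.symm
      have hV : eval x.1 (tailMonomial τ v) ≠ 0 := by
        rw [eval_tailMonomial]
        exact Finset.prod_ne_zero_iff.2 fun j hj =>
          pow_ne_zero _ (mul_ne_zero (inv_ne_zero (R.twist_ne_zero hτ hj)) (hx j hj))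
      have hs : ∀ i ∈ tailIdx r,
          x.1 i = (eval x.1 (tailMonomial τ u) / eval x.1 (tailMonomial τ v)) ^ q i * τ i := by
        intro i hi
        have := h _ (Or.inr ⟨i, hi, rfl⟩)
        simp only [map_sub, map_mul, map_pow, eval_C, eval_X, sub_eq_zero] at this
        rw [div_pow, ← this]
        have := R.twist_ne_zero hτ hi
        field_simp
      refine ⟨_, ?_, hs⟩
      have h2 := two_mem_tailIdx R.two_le
      have he2 := he 2 h2
      rw [hs 2 h2, mul_pow, ← pow_mul, R.q_mul_m 2 h2, (R.mem_twists_iff.1 hτ).1 2 h2,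
        mul_comm] at he2
      rwa [mul_left_cancel₀ (pow_ne_zero _ (neg_ne_zero.2 one_ne_zero)) he2]

/-- The vector `(x, y, τ_2, …, τ_r)`, which is nonzero because the `τ_i` with `i ≥ 2` are. -/
def joinPoint (R : ReducedWeights r d p m a g N b q u v) {τ : Fin (r + 1) → ℂ}
    (hτ : τ ∈ twists m) (x y : ℂ) : PuncturedSpace r :=
  ⟨joinTail x y τ, fun h => R.twist_ne_zero hτ (two_mem_tailIdx R.two_le) (by
    rw [← joinTail_tail R.two_le x y τ (two_mem_tailIdx R.two_le), h, Pi.zero_apply])⟩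

theorem joinPoint_mem_branchCone (R : ReducedWeights r d p m a g N b q u v)
    {τ : Fin (r + 1) → ℂ} (hτ : τ ∈ twists m) {x y : ℂ} (h : x ^ m 0 + y ^ m 1 + 1 = 0) :
    R.joinPoint hτ x y ∈ branchCone m q N τ := by
  refine ⟨1, ?_, fun i hi => ?_⟩
  · simpa [joinPoint, joinTail_zero, joinTail_one R.two_le] using h
  · simp [joinPoint, joinTail_tail R.two_le _ _ _ hi]

/-- A point of a branch whose last coordinates are nonzero can be rescaled so that they become
those of `τ`. -/
theorem exists_mk_eq_mk_joinPoint (R : ReducedWeights r d p m a g N b q u v)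
    {τ : Fin (r + 1) → ℂ} (hτ : τ ∈ twists m) {x : PuncturedSpace r} {s : ℂ} (hs0 : s ≠ 0)
    (h0 : x.1 0 ^ m 0 + x.1 1 ^ m 1 + s ^ N = 0)
    (hs : ∀ i ∈ tailIdx r, x.1 i = s ^ q i * τ i) :
    ∃ y z : ℂ, y ^ m 0 + z ^ m 1 + 1 = 0 ∧
      (WeightedProjQuot.mk x : WeightedProjQuot r d p a) =
        WeightedProjQuot.mk (R.joinPoint hτ y z) := by
  obtain ⟨w, hw⟩ := IsAlgClosed.exists_pow_nat_eq s⁻¹ R.g_pos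
  have hw0 : w ≠ 0 := by
    rintro rfl
    rw [zero_pow R.g_pos.ne'] at hw
    exact inv_ne_zero hs0 hw.symm
  refine ⟨w ^ p 0 * x.1 0, w ^ p 1 * x.1 1, ?_, ?_⟩
  · rw [mul_pow, mul_pow, ← pow_mul, ← pow_mul, R.p_mul_m, R.p_mul_m, pow_mul, hw, ← mul_add,
      eq_neg_of_add_eq_zero_left h0, inv_pow, mul_neg, inv_mul_cancel₀ (pow_ne_zero _ hs0),
      neg_add_cancel]
  · refine WeightedProjQuot.mk_eq_mk_iff.2 ⟨Units.mk0 w hw0, 1, one_mem _, fun i => ?_⟩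
    rw [one_zpow, one_mul, Units.val_pow_eq_pow_val, Units.val_mk0]
    by_cases hi : i ∈ tailIdx r
    · rw [hs i hi, R.p_eq i hi, pow_mul, hw, ← mul_assoc, inv_pow,
        inv_mul_cancel₀ (pow_ne_zero _ hs0), one_mul]
      exact joinTail_tail R.two_le _ _ _ hi
    · rcases Fin.eq_zero_or_eq_one_of_notMem_tailIdx R.two_le hi with rfl | rfl
      · exact joinTail_zero _ (w ^ p 1 * x.1 1) τ
      · exact joinTail_one R.two_le _ _ τ

end ReducedWeights

/-! ### Irreducibility of the branches -/

namespace ReducedWeights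

variable {r d : ℕ} {p m : Fin (r + 1) → ℕ} {a : Fin (r + 1) → ℤ}
  {g N : ℕ} {b : ℤ} {q u v : Fin (r + 1) → ℕ}

/-- The points `[x : y : τ_2 : … : τ_r]` of a branch; they form the image of an affine Fermat
curve. -/
def openBranch (R : ReducedWeights r d p m a g N b q u v) {τ : Fin (r + 1) → ℂ}
    (hτ : τ ∈ twists m) : Set (WeightedProjQuot r d p a) :=
  {z | ∃ x y : ℂ, x ^ m 0 + y ^ m 1 + 1 = 0 ∧ z = WeightedProjQuot.mk (R.joinPoint hτ x y)}

/-- Substitution of the point `(X, Y, τ_2, …, τ_r)`, with `X` the outer and `Y` the inner variable,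
into a polynomial. -/
def substTail {r : ℕ} (τ : Fin (r + 1) → ℂ) :
    MvPolynomial (Fin (r + 1)) ℂ →+* Polynomial (Polynomial ℂ) :=
  eval₂Hom (Polynomial.C.comp Polynomial.C)
    (joinTail Polynomial.X (Polynomial.C Polynomial.X) fun i => Polynomial.C (Polynomial.C (τ i)))

theorem evalEval_substTail (hr : 2 ≤ r) (τ : Fin (r + 1) → ℂ) (x y : ℂ)
    (f : MvPolynomial (Fin (r + 1)) ℂ) :
    (substTail τ f).evalEval y x = eval (joinTail x y τ) f := by
  rw [← Polynomial.coe_evalEvalRingHom, ← RingHom.comp_apply]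
  congr 1
  refine MvPolynomial.ringHom_ext (fun c => ?_) fun i => ?_
  · rw [RingHom.comp_apply, substTail, eval₂Hom_C, eval_C, Polynomial.coe_evalEvalRingHom]
    exact Polynomial.evalEval_CC y x c
  · rw [RingHom.comp_apply, substTail, eval₂Hom_X', eval_X, Polynomial.coe_evalEvalRingHom]
    by_cases hi : i ∈ tailIdx r
    · rw [joinTail_tail hr _ _ _ hi, joinTail_tail hr _ _ _ hi]
      exact Polynomial.evalEval_CC y x _
    · rcases Fin.eq_zero_or_eq_one_of_notMem_tailIdx hr hi with rfl | rfl
      · rw [joinTail_zero, joinTail_zero, Polynomial.evalEval_X]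
      · rw [joinTail_one hr, joinTail_one hr, Polynomial.evalEval_C, Polynomial.eval_X]

theorem isIrreducible_openBranch (R : ReducedWeights r d p m a g N b q u v)
    {τ : Fin (r + 1) → ℂ} (hτ : τ ∈ twists m) : IsIrreducible (R.openBranch hτ) := by
  constructor
  · obtain ⟨y, hy⟩ := IsAlgClosed.exists_pow_nat_eq (-1 : ℂ) (R.m_pos 1)
    exact ⟨_, 0, y, by rw [hy, zero_pow (R.m_pos 0).ne']; ring, rfl⟩
  · rw [isPreirreducible_iff_isClosed_union_isClosed]
    intro Z₁ Z₂ h₁ h₂ hsub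
    obtain ⟨S₁, hS₁⟩ := (WeightedProjQuot.isClosed_iff _).1 h₁
    obtain ⟨S₂, hS₂⟩ := (WeightedProjQuot.isClosed_iff _).1 h₂
    by_contra! hcon
    obtain ⟨⟨_, ⟨x₁, y₁, he₁, rfl⟩, hn₁⟩, ⟨_, ⟨x₂, y₂, he₂, rfl⟩, hn₂⟩⟩ :=
      hcon.imp Set.not_subset.1 Set.not_subset.1
    rw [hS₁] at hn₁
    rw [hS₂] at hn₂
    push Not at hn₁ hn₂
    obtain ⟨f₁, hf₁, hv₁⟩ := hn₁
    obtain ⟨f₂, hf₂, hv₂⟩ := hn₂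
    have hmul := fermatCurve_vanish_of_mul (R.m_pos 0) (R.m_pos 1)
      (f := substTail τ f₁) (g := substTail τ f₂) (by
        intro x y hxy
        rw [evalEval_substTail R.two_le, evalEval_substTail R.two_le]
        exact (hsub ⟨x, y, hxy, rfl⟩).imp
          (fun h => (hS₁ (R.joinPoint hτ x y)).1 h f₁ hf₁)
          fun h => (hS₂ (R.joinPoint hτ x y)).1 h f₂ hf₂)
    rcases hmul with h | h
    · apply hv₁
      have := h x₁ y₁ he₁
      rwa [evalEval_substTail R.two_le] at this
    · apply hv₂
      have := h x₂ y₂ he₂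
      rwa [evalEval_substTail R.two_le] at this

/-- The points of a branch with vanishing last coordinates are limits, in the Euclidean topology
of the cone, of points with `s ≠ 0`: only `x_0` has to be corrected, by a root close to `1`. -/
theorem branch_subset_closure_openBranch (R : ReducedWeights r d p m a g N b q u v)
    {τ : Fin (r + 1) → ℂ} (hτ : τ ∈ twists m) :
    branch d p a m q N τ ⊆ closure (R.openBranch hτ) := by
  have hopen : ∀ (x : PuncturedSpace r) (s : ℂ), s ≠ 0 → x.1 0 ^ m 0 + x.1 1 ^ m 1 + s ^ N = 0 →
      (∀ i ∈ tailIdx r, x.1 i = s ^ q i * τ i) →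
      (WeightedProjQuot.mk x : WeightedProjQuot r d p a) ∈ R.openBranch hτ := by
    intro x s hs0 h0 hs
    obtain ⟨y, z, hyz, h⟩ := R.exists_mk_eq_mk_joinPoint hτ hs0 h0 hs
    exact ⟨y, z, hyz, h⟩
  rintro _ ⟨x, ⟨s, h0, hs⟩, rfl⟩
  by_cases hs0 : s ≠ 0
  · exact subset_closure (hopen x s hs0 h0 hs)
  push Not at hs0
  subst hs0
  rw [zero_pow R.N_pos.ne', add_zero] at h0
  have htail : ∀ i ∈ tailIdx r, x.1 i = 0 := fun i hi => by
    rw [hs i hi, zero_pow (R.q_pos hi).ne', zero_mul]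
  have hx0 : x.1 0 ≠ 0 := by
    intro hx0
    rw [hx0, zero_pow (R.m_pos 0).ne', zero_add, pow_eq_zero_iff (R.m_pos 1).ne'] at h0
    refine x.2 (funext fun i => ?_)
    by_cases hi : i ∈ tailIdx r
    · exact htail i hi
    · rcases Fin.eq_zero_or_eq_one_of_notMem_tailIdx R.two_le hi with rfl | rfl
      · exact hx0
      · exact h0
  obtain ⟨S, hS⟩ := (WeightedProjQuot.isClosed_iff _).1
    (isClosed_closure (s := R.openBranch hτ))
  rw [hS]
  intro f hf
  -- the path `γ` stays on the cone of the branch and ends in `x` at `s = 0`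
  set c : ℂ → ℂ := fun s => (1 - s ^ N / x.1 0 ^ m 0) ^ ((m 0 : ℂ)⁻¹) with hc
  set γ : ℂ → Fin (r + 1) → ℂ := fun s =>
    joinTail (x.1 0 * c s) (x.1 1) (fun i => s ^ q i * τ i) with hγ
  have hc0 : c 0 = 1 := by simp [hc, R.N_pos.ne']
  have hγ0 : γ 0 = x.1 := by
    funext i
    simp only [hγ]
    by_cases hi : i ∈ tailIdx r
    · rw [joinTail_tail R.two_le _ _ _ hi, htail i hi, zero_pow (R.q_pos hi).ne', zero_mul]
    · rcases Fin.eq_zero_or_eq_one_of_notMem_tailIdx R.two_le hi with rfl | rfl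
      · rw [joinTail_zero, hc0, mul_one]
      · rw [joinTail_one R.two_le]
  have hcc : ContinuousAt c 0 := by
    apply ContinuousAt.cpow (by fun_prop) continuousAt_const
    simp [R.N_pos.ne']
  have hγc : ContinuousAt γ 0 := by
    refine continuousAt_pi.2 fun i => ?_
    by_cases hi : i ∈ tailIdx r
    · simp only [hγ, joinTail_tail R.two_le _ _ _ hi]
      fun_prop
    · rcases Fin.eq_zero_or_eq_one_of_notMem_tailIdx R.two_le hi with rfl | rfl
      · simp only [hγ, joinTail_zero]
        exact continuousAt_const.mul hcc
      · simp only [hγ, joinTail_one R.two_le]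
        exact continuousAt_const
  have hvan : ∀ s : ℂ, s ≠ 0 → eval (γ s) f = 0 := by
    intro s hs0
    have hγt : ∀ i ∈ tailIdx r, γ s i = s ^ q i * τ i := fun i hi => joinTail_tail R.two_le _ _ _ hi
    have hne : γ s ≠ 0 := fun h => by
      have h2 := two_mem_tailIdx R.two_le
      have := hγt 2 h2
      rw [h, Pi.zero_apply] at this
      exact mul_ne_zero (pow_ne_zero _ hs0) (R.twist_ne_zero hτ h2) this.symm
    refine (hS ⟨γ s, hne⟩).1 (subset_closure (hopen _ s hs0 ?_ hγt)) f hf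
    have e0 : γ s 0 = x.1 0 * c s := joinTail_zero _ _ _
    have e1 : γ s 1 = x.1 1 := joinTail_one R.two_le _ _ _
    change γ s 0 ^ m 0 + γ s 1 ^ m 1 + s ^ N = 0
    rw [e0, e1, mul_pow, hc, Complex.cpow_nat_inv_pow _ (R.m_pos 0).ne', mul_sub,
      mul_div_cancel₀ _ (pow_ne_zero _ hx0), mul_one, ← h0]
    ring
  have hlim : Filter.Tendsto (fun s => eval (γ s) f) (nhdsWithin 0 {0}ᶜ) (nhds (eval (γ 0) f)) :=
    (((MvPolynomial.continuous_eval f).continuousAt).comp hγc).tendsto.mono_left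
      nhdsWithin_le_nhds
  have hzero : Filter.Tendsto (fun s => eval (γ s) f) (nhdsWithin 0 {0}ᶜ) (nhds 0) :=
    tendsto_const_nhds.congr' (by
      filter_upwards [self_mem_nhdsWithin] with s hs0
      exact (hvan s hs0).symm)
  rw [← hγ0]
  exact tendsto_nhds_unique hlim hzero

theorem openBranch_subset_branch (R : ReducedWeights r d p m a g N b q u v)
    {τ : Fin (r + 1) → ℂ} (hτ : τ ∈ twists m) : R.openBranch hτ ⊆ branch d p a m q N τ := by
  rintro _ ⟨x, y, h, rfl⟩
  exact ⟨_, R.joinPoint_mem_branchCone hτ h, rfl⟩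

theorem isIrreducible_branch (R : ReducedWeights r d p m a g N b q u v)
    {τ : Fin (r + 1) → ℂ} (hτ : τ ∈ twists m) : IsIrreducible (branch d p a m q N τ) := by
  have : branch d p a m q N τ = closure (R.openBranch hτ) :=
    (R.branch_subset_closure_openBranch hτ).antisymm
      (closure_minimal (R.openBranch_subset_branch hτ) (R.isClosed_branch hτ))
  rw [this]
  exact isIrreducible_iff_closure.2 (R.isIrreducible_openBranch hτ)

/-! ### The number of branches -/

theorem branchCone_subset_of_mem (R : ReducedWeights r d p m a g N b q u v)
    {τ τ' : Fin (r + 1) → ℂ} {x : PuncturedSpace r}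
    (hx : x ∈ branchCone m q N τ) (hx' : x ∈ branchCone m q N τ') {i : Fin (r + 1)}
    (hi : i ∈ tailIdx r) (hxi : x.1 i ≠ 0) : branchCone m q N τ ⊆ branchCone m q N τ' := by
  obtain ⟨s, h0, hs⟩ := hx
  obtain ⟨s', h0', hs'⟩ := hx'
  have hs0 : s ≠ 0 := by
    rintro rfl
    rw [hs i hi, zero_pow (R.q_pos hi).ne', zero_mul] at hxi
    exact hxi rfl
  rintro y ⟨w, k0, hw⟩
  refine ⟨w * (s' / s), ?_, fun j hj => ?_⟩
  · rw [mul_pow, div_pow, add_left_cancel (h0'.trans h0.symm), div_self (pow_ne_zero _ hs0),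
      mul_one, k0]
  · have := (hs j hj).symm.trans (hs' j hj)
    rw [hw j hj, mul_pow, div_pow, mul_assoc, div_mul_eq_mul_div, ← this,
      mul_div_cancel_left₀ _ (pow_ne_zero _ hs0)]

theorem branch_eq_of_mem (R : ReducedWeights r d p m a g N b q u v)
    {τ τ' : Fin (r + 1) → ℂ} {x : PuncturedSpace r}
    (hx : x ∈ branchCone m q N τ) (hx' : x ∈ branchCone m q N τ') {i : Fin (r + 1)}
    (hi : i ∈ tailIdx r) (hxi : x.1 i ≠ 0) : branch d p a m q N τ = branch d p a m q N τ' := by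
  unfold branch
  rw [(R.branchCone_subset_of_mem hx hx' hi hxi).antisymm
    (R.branchCone_subset_of_mem hx' hx hi hxi)]

/-- Every branch has points whose last coordinates are those of `τ`. -/
theorem exists_mem_branchCone (R : ReducedWeights r d p m a g N b q u v)
    {τ : Fin (r + 1) → ℂ} (hτ : τ ∈ twists m) :
    ∃ x ∈ branchCone m q N τ, ∀ i ∈ tailIdx r, x.1 i = τ i := by
  obtain ⟨y, hy⟩ := IsAlgClosed.exists_pow_nat_eq (-1 : ℂ) (R.m_pos 1)
  exact ⟨R.joinPoint hτ 0 y,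
    R.joinPoint_mem_branchCone hτ (by rw [hy, zero_pow (R.m_pos 0).ne']; ring),
    fun i hi => joinTail_tail R.two_le _ _ _ hi⟩

theorem branch_eq_of_subset (R : ReducedWeights r d p m a g N b q u v)
    {τ τ' : Fin (r + 1) → ℂ} (hτ : τ ∈ twists m)
    (h : branch d p a m q N τ ⊆ branch d p a m q N τ') :
    branch d p a m q N τ = branch d p a m q N τ' := by
  obtain ⟨x, hx, hxt⟩ := R.exists_mem_branchCone hτ
  have h2 := two_mem_tailIdx R.two_le
  exact R.branch_eq_of_mem hx (R.mk_mem_branch_iff.1 (h ⟨x, hx, rfl⟩)) h2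
    (by rw [hxt 2 h2]; exact R.twist_ne_zero hτ h2)

theorem branch_eq_iff (R : ReducedWeights r d p m a g N b q u v)
    {τ τ' : Fin (r + 1) → ℂ} (hτ : τ ∈ twists m) (hτ' : τ' ∈ twists m) :
    branch d p a m q N τ' = branch d p a m q N τ ↔
      ∃ s : ℂ, s ^ N = 1 ∧ (fun i => s ^ q i * τ i) = τ' := by
  obtain ⟨x, hx, hxt⟩ := R.exists_mem_branchCone hτ'
  have h2 := two_mem_tailIdx R.two_le
  constructor
  · intro h
    obtain ⟨s, -, hs⟩ := R.mk_mem_branch_iff.1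
      (h ▸ ⟨x, hx, rfl⟩ : WeightedProjQuot.mk x ∈ branch d p a m q N τ)
    have hst : ∀ i ∈ tailIdx r, s ^ q i * τ i = τ' i := fun i hi => by rw [← hs i hi, hxt i hi]
    refine ⟨s, ?_, funext fun i => ?_⟩
    · have h1 := congrArg (· ^ m 2) (hst 2 h2)
      simp only [mul_pow] at h1
      rw [← pow_mul, R.q_mul_m 2 h2, (R.mem_twists_iff.1 hτ).1 2 h2,
        (R.mem_twists_iff.1 hτ').1 2 h2] at h1
      exact mul_right_cancel₀ (pow_ne_zero _ (neg_ne_zero.2 one_ne_zero))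
        (h1.trans (one_mul _).symm)
    · by_cases hi : i ∈ tailIdx r
      · exact hst i hi
      · rw [(R.mem_twists_iff.1 hτ).2 i hi, (R.mem_twists_iff.1 hτ').2 i hi, mul_zero]
  · rintro ⟨s, hsN, rfl⟩
    have hx2 := hxt 2 h2
    refine R.branch_eq_of_mem hx ?_ h2 (by rw [hx2]; exact R.twist_ne_zero hτ' h2)
    obtain ⟨w, k0, hw⟩ := hx
    exact ⟨w * s, by rw [mul_pow, hsN, mul_one, k0],
      fun i hi => by rw [hw i hi, mul_pow, mul_assoc]⟩

/-- Two twists have the same branch exactly if they lie in one orbit of the group of `N`-th roots of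
unity, which acts freely through `s ↦ (s ^ q_i)`. -/
theorem ncard_branches (R : ReducedWeights r d p m a g N b q u v) :
    (branch d p a m q N '' (twists m : Set (Fin (r + 1) → ℂ))).ncard * N =
      ∏ i ∈ tailIdx r, m i := by
  classical
  rw [← Finset.coe_image, Set.ncard_coe_finset, ← R.card_twists,
    Finset.card_eq_sum_card_image (branch d p a m q N) (twists m)]
  symm
  apply Finset.sum_const_nat
  intro Z hZ
  obtain ⟨τ, hτ, rfl⟩ := Finset.mem_image.1 hZ
  have himg : {τ' ∈ twists m | branch d p a m q N τ' = branch d p a m q N τ} =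
      (Polynomial.nthRoots N (1 : ℂ)).toFinset.image fun s i => s ^ q i * τ i := by
    ext τ'
    simp only [Finset.mem_filter, Finset.mem_image, Multiset.mem_toFinset,
      Polynomial.mem_nthRoots R.N_pos]
    constructor
    · rintro ⟨hτ', h⟩
      exact (R.branch_eq_iff hτ hτ').1 h
    · intro h
      have hτ' : τ' ∈ twists m := by
        obtain ⟨s, hs, rfl⟩ := h
        refine R.mem_twists_iff.2 ⟨fun i hi => ?_, fun i hi => ?_⟩
        · rw [mul_pow, ← pow_mul, R.q_mul_m i hi, hs, one_mul, (R.mem_twists_iff.1 hτ).1 i hi]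
        · rw [(R.mem_twists_iff.1 hτ).2 i hi, mul_zero]
      exact ⟨hτ', (R.branch_eq_iff hτ hτ').2 h⟩
  rw [himg, Finset.card_image_of_injOn, Complex.card_nthRoots_toFinset R.N_pos one_ne_zero]
  intro s _ t ht hst
  have ht : t ^ N = 1 := by
    simpa [Polynomial.mem_nthRoots R.N_pos] using ht
  refine R.pow_injective (fun h => ?_) fun i hi =>
    mul_right_cancel₀ (R.twist_ne_zero hτ hi) (congrFun hst i)
  rw [h, zero_pow R.N_pos.ne'] at ht
  exact zero_ne_one ht

theorem componentsOf_zeroSet (R : ReducedWeights r d p m a g N b q u v) :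
    componentsOf (WeightedProjQuot.zeroSet (fermatSystem r m) : Set (WeightedProjQuot r d p a)) =
      branch d p a m q N '' (twists m : Set (Fin (r + 1) → ℂ)) := by
  rw [R.zeroSet_fermatSystem]
  apply componentsOf_sUnion ((Finset.finite_toSet _).image _)
  · rintro _ ⟨τ, hτ, rfl⟩
    exact R.isClosed_branch hτ
  · rintro _ ⟨τ, hτ, rfl⟩
    exact R.isIrreducible_branch hτ
  · rintro _ ⟨τ, hτ, rfl⟩ _ ⟨τ', hτ', rfl⟩ h
    exact R.branch_eq_of_subset hτ h

end ReducedWeights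

/-! ### Points on the coordinate hyperplanes -/

theorem Complex.exists_units_isPrimitiveRoot {n : ℕ} (hn : 0 < n) :
    ∃ ζ : ℂˣ, IsPrimitiveRoot ζ n := by
  have h := Complex.isPrimitiveRoot_exp n hn.ne'
  refine ⟨Units.mk0 _ (h.ne_zero hn.ne'), ?_⟩
  rw [← IsPrimitiveRoot.coe_units_iff]
  exact h

/-- The values of the character `(t, ξ) ↦ ξ ^ α * t ^ π` on the subgroup `ξ ^ b * t ^ g = 1` of
`ℂ^* × μ_d` are the `n`-th roots of unity, `n` being the quotient of the order `d g` of this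
subgroup by the greatest common divisor of `d g`, `d π` and `α g - π b`. -/
theorem exists_stabilizer_iff_pow_eq_one {d g π n : ℕ} {α b : ℤ} (hd : 0 < d) (hg : 0 < g)
    (hn : n * Int.gcd (d * Nat.gcd π g) (α * g - π * b) = d * g) (η : ℂˣ) :
    (∃ t : ℂˣ, ∃ ξ ∈ rootsOfUnity d ℂ, ξ ^ b * t ^ g = 1 ∧ η = ξ ^ α * t ^ π) ↔ η ^ n = 1 := by
  set e := Int.gcd (d * Nat.gcd π g) (α * g - π * b) with he
  have hdZ : (d : ℤ) ≠ 0 := by exact_mod_cast hd.ne'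
  have hgZ : (g : ℤ) ≠ 0 := by exact_mod_cast hg.ne'
  have hnZ : (n : ℤ) * e = d * g := by exact_mod_cast hn
  constructor
  · rintro ⟨t, ξ, hξ, h1, rfl⟩
    rw [mem_rootsOfUnity] at hξ
    obtain ⟨c, hc⟩ : (e : ℤ) ∣ d * π := (Int.gcd_dvd_left _ _).trans
      (mul_dvd_mul_left _ (Int.natCast_dvd_natCast.2 (Nat.gcd_dvd_left π g)))
    obtain ⟨c', hc'⟩ : (e : ℤ) ∣ α * g - π * b := Int.gcd_dvd_right _ _
    have h2 : (n : ℤ) * π = g * c := by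
      apply mul_left_cancel₀ hdZ
      linear_combination (n : ℤ) * hc + c * hnZ
    have h3 : (n : ℤ) * α = b * c + d * c' := by
      apply mul_left_cancel₀ hgZ
      linear_combination (n : ℤ) * hc' + c' * hnZ + b * h2
    have key : (ξ ^ α * t ^ π) ^ n = (ξ ^ b * t ^ g) ^ c * (ξ ^ d) ^ c' := by
      have e1 : (ξ ^ α) ^ n = ξ ^ (b * c + d * c') := by
        rw [← zpow_natCast, ← zpow_mul, mul_comm, h3]
      have e2 : (t ^ π) ^ n = t ^ ((g : ℤ) * c) := by
        rw [← h2, ← pow_mul, mul_comm π n, ← zpow_natCast, Nat.cast_mul]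
      rw [mul_pow, e1, e2, zpow_add, zpow_mul, zpow_mul, zpow_mul, zpow_natCast, zpow_natCast,
        mul_zpow]
      exact mul_right_comm _ _ _
    rw [key, h1, hξ, one_zpow, one_zpow, one_mul]
  · intro hη
    obtain ⟨ζ, hζ⟩ := Complex.exists_units_isPrimitiveRoot (Nat.mul_pos hd hg)
    have hn0 : n ≠ 0 := by
      rintro rfl
      rw [zero_mul] at hn
      exact (Nat.mul_pos hd hg).ne hn
    have : NeZero n := ⟨hn0⟩
    have hζe : IsPrimitiveRoot (ζ ^ e) n :=
      hζ.pow (Nat.mul_pos hd hg) (hn.symm.trans (mul_comm _ _))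
    obtain ⟨j, hj⟩ : ∃ j : ℕ, (ζ ^ e) ^ j = η := by
      obtain ⟨j, -, hj⟩ := (IsPrimitiveRoot.coe_units_iff.2 hζe).eq_pow_of_pow_eq_one
        (ξ := (η : ℂ)) (by rw [← Units.val_pow_eq_pow_val, hη, Units.val_one])
      exact ⟨j, Units.ext (by rw [Units.val_pow_eq_pow_val, hj])⟩
    -- a Bézout relation `e = d π X + d g Y + (α g - π b) Z`
    obtain ⟨X, Y, Z, hB⟩ : ∃ X Y Z : ℤ, (e : ℤ) = d * π * X + d * g * Y + (α * g - π * b) * Z := by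
      have h1 := Int.gcd_eq_gcd_ab (d * Nat.gcd π g) (α * g - π * b)
      have h2 := Nat.gcd_eq_gcd_ab π g
      rw [← he] at h1
      refine ⟨Nat.gcdA π g * Int.gcdA (d * Nat.gcd π g) (α * g - π * b),
        Nat.gcdB π g * Int.gcdA (d * Nat.gcd π g) (α * g - π * b),
        Int.gcdB (d * Nat.gcd π g) (α * g - π * b), ?_⟩
      rw [h1]
      linear_combination (d : ℤ) * Int.gcdA (d * Nat.gcd π g) (α * g - π * b) * h2
    have hone : ∀ k : ℤ, ζ ^ ((d : ℤ) * g * k) = 1 := fun k => by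
      rw [zpow_mul, ← Nat.cast_mul, zpow_natCast, hζ.pow_eq_one, one_zpow]
    refine ⟨ζ ^ (d * (X * j) - b * (Z * j)), ζ ^ ((g : ℤ) * (Z * j)), ?_, ?_, ?_⟩
    · rw [mem_rootsOfUnity, ← zpow_natCast, ← zpow_mul, ← hone (Z * j)]
      congr 1
      ring
    · rw [← zpow_natCast (ζ ^ _) g, ← zpow_mul, ← zpow_mul, ← zpow_add, ← hone (X * j)]
      congr 1
      ring
    · rw [← hj, ← zpow_natCast (ζ ^ _) π, ← zpow_mul, ← zpow_mul, ← zpow_add, ← pow_mul,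
        ← mul_one (ζ ^ ((g : ℤ) * (Z * j) * α + _)), ← hone (Y * j), ← zpow_add, ← zpow_natCast]
      congr 1
      push_cast
      linear_combination (j : ℤ) * hB

namespace ReducedWeights

variable {r d : ℕ} {p m : Fin (r + 1) → ℕ} {a : Fin (r + 1) → ℤ}
  {g N : ℕ} {b : ℤ} {q u v : Fin (r + 1) → ℕ}

theorem exists_branch_inter_hyperplane_eq_image (R : ReducedWeights r d p m a g N b q u v)
    {τ : Fin (r + 1) → ℂ} (hτ : τ ∈ twists m) {l l' : Fin (r + 1)}
    (hl : l = 0 ∧ l' = 1 ∨ l = 1 ∧ l' = 0) :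
    ∃ pt : ℂ → PuncturedSpace r,
      (∀ y, (pt y).1 l = 0 ∧ (pt y).1 l' = y ∧ ∀ i ∈ tailIdx r, (pt y).1 i = τ i) ∧
      branch d p a m q N τ ∩ WeightedProjQuot.hyperplane l =
        (fun y => WeightedProjQuot.mk (pt y)) '' {y : ℂ | y ^ m l' = -1} := by
  have hsub : ∀ z ∈ branch d p a m q N τ ∩ WeightedProjQuot.hyperplane l,
      ∃ x y : ℂ, x ^ m 0 + y ^ m 1 + 1 = 0 ∧ (R.joinPoint hτ x y).1 l = 0 ∧
        z = WeightedProjQuot.mk (R.joinPoint hτ x y) := by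
    rintro _ ⟨⟨x, ⟨s, h0, hs⟩, rfl⟩, hxl⟩
    have hxl' := WeightedProjQuot.mk_mem_hyperplane_iff.1 hxl
    have hs0 : s ≠ 0 := by
      rintro rfl
      refine x.2 (funext fun i => ?_)
      rw [zero_pow R.N_pos.ne', add_zero] at h0
      by_cases hi : i ∈ tailIdx r
      · rw [hs i hi, zero_pow (R.q_pos hi).ne', zero_mul, Pi.zero_apply]
      · rcases hl with ⟨rfl, -⟩ | ⟨rfl, -⟩
        · rw [hxl', zero_pow (R.m_pos 0).ne', zero_add, pow_eq_zero_iff (R.m_pos 1).ne'] at h0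
          rcases Fin.eq_zero_or_eq_one_of_notMem_tailIdx R.two_le hi with rfl | rfl
          exacts [hxl', h0]
        · rw [hxl', zero_pow (R.m_pos 1).ne', add_zero, pow_eq_zero_iff (R.m_pos 0).ne'] at h0
          rcases Fin.eq_zero_or_eq_one_of_notMem_tailIdx R.two_le hi with rfl | rfl
          exacts [h0, hxl']
    obtain ⟨y, z, hyz, h⟩ := R.exists_mk_eq_mk_joinPoint hτ hs0 h0 hs
    exact ⟨y, z, hyz, WeightedProjQuot.mk_mem_hyperplane_iff.1 (h ▸ hxl), h⟩
  have c0 : ∀ x y, (R.joinPoint hτ x y).1 0 = x := fun x y => joinTail_zero x y τ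
  have c1 : ∀ x y, (R.joinPoint hτ x y).1 1 = y := fun x y => joinTail_one R.two_le x y τ
  have ct : ∀ x y, ∀ i ∈ tailIdx r, (R.joinPoint hτ x y).1 i = τ i :=
    fun x y i hi => joinTail_tail R.two_le x y τ hi
  rcases hl with ⟨rfl, rfl⟩ | ⟨rfl, rfl⟩
  · refine ⟨fun y => R.joinPoint hτ 0 y, fun y => ⟨c0 0 y, c1 0 y, ct 0 y⟩,
      Set.Subset.antisymm (fun z hz => ?_) ?_⟩
    · obtain ⟨x, y, hxy, hx, rfl⟩ := hsub z hz
      rw [c0] at hx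
      subst hx
      rw [zero_pow (R.m_pos 0).ne', zero_add] at hxy
      exact ⟨y, eq_neg_of_add_eq_zero_left hxy, rfl⟩
    · rintro _ ⟨y, hy, rfl⟩
      have hy : y ^ m 1 = -1 := hy
      exact ⟨⟨_, R.joinPoint_mem_branchCone hτ
        (by rw [hy, zero_pow (R.m_pos 0).ne', zero_add, neg_add_cancel]), rfl⟩,
        WeightedProjQuot.mk_mem_hyperplane_iff.2 (c0 0 y)⟩
  · refine ⟨fun y => R.joinPoint hτ y 0, fun y => ⟨c1 y 0, c0 y 0, ct y 0⟩,
      Set.Subset.antisymm (fun z hz => ?_) ?_⟩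
    · obtain ⟨x, y, hxy, hy, rfl⟩ := hsub z hz
      rw [c1] at hy
      subst hy
      rw [zero_pow (R.m_pos 1).ne', add_zero] at hxy
      exact ⟨x, eq_neg_of_add_eq_zero_left hxy, rfl⟩
    · rintro _ ⟨y, hy, rfl⟩
      have hy : y ^ m 0 = -1 := hy
      exact ⟨⟨_, R.joinPoint_mem_branchCone hτ
        (by rw [hy, zero_pow (R.m_pos 1).ne', add_zero, neg_add_cancel]), rfl⟩,
        WeightedProjQuot.mk_mem_hyperplane_iff.2 (c1 y 0)⟩

/-- The stabilizer of the last coordinates acts on the remaining one through the `n`-th roots of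
unity, so the points are classified by `y ^ n`, which runs through the roots of
`w ^ (m / n) = -1`. -/
theorem ncard_branch_inter_hyperplane (R : ReducedWeights r d p m a g N b q u v)
    {τ : Fin (r + 1) → ℂ} (hτ : τ ∈ twists m) {l l' : Fin (r + 1)}
    (hl : l = 0 ∧ l' = 1 ∨ l = 1 ∧ l' = 0) :
    (branch d p a m q N τ ∩ WeightedProjQuot.hyperplane l).Finite ∧
      (branch d p a m q N τ ∩ WeightedProjQuot.hyperplane l).ncard * (d * g) =
        m l' * Int.gcd (d * Nat.gcd (p l') g) (a l' * g - p l' * b) := by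
  obtain ⟨pt, hpt, himg⟩ := R.exists_branch_inter_hyperplane_eq_image hτ hl
  set e := Int.gcd (d * Nat.gcd (p l') g) (a l' * g - p l' * b) with he
  -- `n` is the order of the group through which the stabilizer acts
  obtain ⟨n, hn⟩ : e ∣ d * g := by
    rw [← Int.natCast_dvd_natCast, Nat.cast_mul]
    exact (Int.gcd_dvd_left _ _).trans
      (mul_dvd_mul_left _ (Int.natCast_dvd_natCast.2 (Nat.gcd_dvd_right _ _)))
  rw [mul_comm e] at hn
  have hstab := exists_stabilizer_iff_pow_eq_one (α := a l') R.d_pos R.g_pos hn.symm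
  have hn0 : 0 < n := Nat.pos_of_mul_pos_right (by rw [← hn]; exact Nat.mul_pos R.d_pos R.g_pos)
  -- the stabilizer preserves the equation `y ^ m = -1`
  obtain ⟨k, hk⟩ : n ∣ m l' := by
    obtain ⟨η, hη⟩ := Complex.exists_units_isPrimitiveRoot hn0
    obtain ⟨t, ξ, hξ, h1, h2⟩ := (hstab η).2 hη.pow_eq_one
    apply hη.dvd_of_pow_eq_one
    rw [h2, R.scalar_pow_m t hξ, ← R.scalar_pow_N t hξ, h1, one_pow]
  have hk0 : 0 < k := Nat.pos_of_mul_pos_left (by rw [← hk]; exact R.m_pos l')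
  have hmk : ∀ y y' : ℂ, y ≠ 0 → y' ≠ 0 →
      ((WeightedProjQuot.mk (pt y) : WeightedProjQuot r d p a) = WeightedProjQuot.mk (pt y') ↔
        y ^ n = y' ^ n) := by
    intro y y' hy hy'
    obtain ⟨y0, y1, yt⟩ := hpt y
    obtain ⟨y0', y1', yt'⟩ := hpt y'
    rw [WeightedProjQuot.mk_eq_mk_iff]
    constructor
    · rintro ⟨t, ξ, hξ, h⟩
      have h1 : ξ ^ b * t ^ g = 1 := by
        refine Units.ext (R.pow_injective (s := ((ξ ^ b * t ^ g : ℂˣ) : ℂ))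
          (t := ((1 : ℂˣ) : ℂ)) one_ne_zero fun i hi => ?_)
        have hi' := h i
        rw [yt i hi, yt' i hi, R.scalar_eq_pow t ξ hi, Units.val_pow_eq_pow_val] at hi'
        rw [Units.val_one, one_pow]
        exact mul_right_cancel₀ (R.twist_ne_zero hτ hi) (hi'.symm.trans (one_mul _).symm)
      have h2 := (hstab _).1 ⟨t, ξ, hξ, h1, rfl⟩
      have h3 := h l'
      rw [y1, y1'] at h3
      rw [h3, mul_pow, ← Units.val_pow_eq_pow_val, h2, Units.val_one, one_mul]
    · intro h
      obtain ⟨t, ξ, hξ, h1, h2⟩ := (hstab (Units.mk0 y' hy' / Units.mk0 y hy)).2 (by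
        refine Units.ext ?_
        rw [Units.val_pow_eq_pow_val, Units.val_div_eq_div_val, Units.val_mk0, Units.val_mk0,
          div_pow, h, div_self (pow_ne_zero _ hy'), Units.val_one])
      refine ⟨t, ξ, hξ, fun i => ?_⟩
      by_cases hi : i ∈ tailIdx r
      · rw [yt i hi, yt' i hi, R.scalar_eq_pow t ξ hi, h1, one_pow, Units.val_one, one_mul]
      · have hil : i = l ∨ i = l' := by
          rcases Fin.eq_zero_or_eq_one_of_notMem_tailIdx R.two_le hi with rfl | rfl <;>
          rcases hl with ⟨rfl, rfl⟩ | ⟨rfl, rfl⟩ <;> simp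
        rcases hil with rfl | rfl
        · rw [y0, y0', mul_zero]
        · rw [y1, y1', ← h2, Units.val_div_eq_div_val, Units.val_mk0, Units.val_mk0,
            div_mul_cancel₀ _ hy]
  have hne : ∀ y : ℂ, y ^ m l' = -1 → y ≠ 0 := by
    rintro _ hy rfl
    rw [zero_pow (R.m_pos l').ne'] at hy
    norm_num at hy
  choose ρ hρ using fun w : ℂ => IsAlgClosed.exists_pow_nat_eq w hn0
  have hρm : ∀ w : ℂ, w ^ k = -1 → ρ w ^ m l' = -1 := fun w hw => by rw [hk, pow_mul, hρ, hw]
  have himg' : branch d p a m q N τ ∩ WeightedProjQuot.hyperplane l =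
      (fun w => WeightedProjQuot.mk (pt (ρ w))) '' {w : ℂ | w ^ k = -1} := by
    rw [himg]
    apply Set.Subset.antisymm
    · rintro _ ⟨y, hy, rfl⟩
      have hy : y ^ m l' = -1 := hy
      have hyk : (y ^ n) ^ k = -1 := by rw [← pow_mul, ← hk, hy]
      exact ⟨y ^ n, hyk, (hmk _ _ (hne _ (hρm _ hyk)) (hne y hy)).2 (hρ _)⟩
    · rintro _ ⟨w, hw, rfl⟩
      exact ⟨ρ w, hρm w hw, rfl⟩
  obtain ⟨hfin, hcard⟩ := Complex.ncard_setOf_pow_eq hk0 (neg_ne_zero.2 (one_ne_zero (α := ℂ)))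
  rw [himg']
  refine ⟨hfin.image _, ?_⟩
  rw [Set.InjOn.ncard_image, hcard, hn, hk]
  · ring
  · intro w hw w' hw' h
    rw [← hρ w, ← hρ w']
    exact (hmk _ _ (hne _ (hρm w hw)) (hne _ (hρm w' hw'))).1 h

/-- The count of points in terms of the unreduced weights. -/
theorem ncard_branch_inter_hyperplane_eq (R : ReducedWeights r d p m a g N b q u v)
    {τ : Fin (r + 1) → ℂ} (hτ : τ ∈ twists m) {l l' : Fin (r + 1)}
    (hl : l = 0 ∧ l' = 1 ∨ l = 1 ∧ l' = 0) (hg : g = (tailIdx r).gcd p) {P : ℕ} {Q : ℤ}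
    (hP : 0 < P) (hQ : Q * g = b * P) :
    (branch d p a m q N τ ∩ WeightedProjQuot.hyperplane l).Finite ∧
      ((branch d p a m q N τ ∩ WeightedProjQuot.hyperplane l).ncard : ℚ) =
        ((m l' : ℚ) * (Int.gcd
          ((d : ℤ) * (P : ℤ) * (((insert l' (tailIdx r)).gcd p : ℕ) : ℤ))
          ((a l' * (P : ℤ) - (p l' : ℤ) * Q) * (((tailIdx r).gcd p : ℕ) : ℤ)) : ℚ)) /
            ((d : ℚ) * (P : ℚ) * (((tailIdx r).gcd p : ℕ) : ℚ)) := by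
  obtain ⟨hfin, hcard⟩ := R.ncard_branch_inter_hyperplane hτ hl
  refine ⟨hfin, ?_⟩
  have e1 : (d : ℤ) * (P : ℤ) * (((insert l' (tailIdx r)).gcd p : ℕ) : ℤ) =
      P * (d * Nat.gcd (p l') g) := by
    rw [Finset.gcd_insert, ← hg]
    change (d : ℤ) * P * (Nat.gcd (p l') g : ℕ) = _
    ring
  have e2 : (a l' * (P : ℤ) - (p l' : ℤ) * Q) * (((tailIdx r).gcd p : ℕ) : ℤ) =
      P * (a l' * g - p l' * b) := by
    rw [← hg]
    linear_combination -(p l' : ℤ) * hQ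
  rw [e1, e2, Int.gcd_mul_left, Int.natAbs_natCast, ← hg, eq_div_iff (by
    have := R.d_pos
    have := R.g_pos
    positivity)]
  have hcard' : ((branch d p a m q N τ ∩ WeightedProjQuot.hyperplane l).ncard : ℚ) * (d * g) =
      m l' * Int.gcd (d * Nat.gcd (p l') g) (a l' * g - p l' * b) := by exact_mod_cast hcard
  push_cast
  linear_combination (P : ℚ) * hcard'

end ReducedWeights

/-! ### The components of the curve and their points -/

theorem mainTheorem7 (r d : ℕ) (hr : 2 ≤ r) (hd : 0 < d)
    (p m : Fin (r + 1) → ℕ) (a : Fin (r + 1) → ℤ)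
    (hp : ∀ i, 0 < p i) (hm : ∀ i, 0 < m i)
    (hdvd : ∀ i, (d : ℤ) ∣ a i * (m i : ℤ))
    (hhom : ∀ f ∈ fermatSystem r m, ∃ k : ℕ, MvPolynomial.IsWeightedHomogeneous p f k)
    (E : Set (WeightedProjQuot r d p a))
    (hE : E = WeightedProjQuot.zeroSet (fermatSystem r m))
    (A : WeightedProjQuot r d p a)
    (hA : ∀ i ∈ tailIdx r, E ∩ WeightedProjQuot.hyperplane i = {A})
    (hap : ∀ i ∈ tailIdx r, ∀ j ∈ tailIdx r, a i * (p j : ℤ) - a j * (p i : ℤ) = 0)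
    (P : ℕ) (hP : P = ∏ i ∈ tailIdx r, p i) :
    -- the number of irreducible components
    ((componentsOf E).Finite ∧
      ((componentsOf E).ncard : ℚ) =
        ((∏ i ∈ tailIdx r, m i : ℕ) : ℚ) / (((tailIdx r).lcm m : ℕ) : ℚ)) ∧
    -- they all contain `A` and are pairwise disjoint outside `A`
    ((∀ C ∈ componentsOf E, A ∈ C) ∧
      (∀ C ∈ componentsOf E, ∀ C' ∈ componentsOf E, C ≠ C' → Disjoint (C \ {A}) (C' \ {A}))) ∧
    -- the number of points of each component on `{x₀ = 0}` and on `{x₁ = 0}`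
    (∃ Q : ℤ, (∀ i ∈ tailIdx r, Q = a i * ∏ j ∈ (tailIdx r).erase i, (p j : ℤ)) ∧
      ∀ C ∈ componentsOf E,
        ((C ∩ WeightedProjQuot.hyperplane 0).Finite ∧
          ((C ∩ WeightedProjQuot.hyperplane 0).ncard : ℚ) =
            ((m 1 : ℚ) * (Int.gcd
                ((d : ℤ) * (P : ℤ) * (((insert 1 (tailIdx r)).gcd p : ℕ) : ℤ))
                ((a 1 * (P : ℤ) - (p 1 : ℤ) * Q) * (((tailIdx r).gcd p : ℕ) : ℤ)) : ℚ)) /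
              ((d : ℚ) * (P : ℚ) * (((tailIdx r).gcd p : ℕ) : ℚ))) ∧
        ((C ∩ WeightedProjQuot.hyperplane 1).Finite ∧
          ((C ∩ WeightedProjQuot.hyperplane 1).ncard : ℚ) =
            ((m 0 : ℚ) * (Int.gcd
                ((d : ℤ) * (P : ℤ) * (((insert 0 (tailIdx r)).gcd p : ℕ) : ℤ))
                ((a 0 * (P : ℤ) - (p 0 : ℤ) * Q) * (((tailIdx r).gcd p : ℕ) : ℤ)) : ℚ)) /
              ((d : ℚ) * (P : ℚ) * (((tailIdx r).gcd p : ℕ) : ℚ)))) := by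
  obtain ⟨N, b, q, u, v, R⟩ := exists_reducedWeights hr hd hp hm hdvd hhom hap
  set g := (tailIdx r).gcd p with hg
  have h2 := two_mem_tailIdx hr
  have hcomp : componentsOf E = branch d p a m q N '' (twists m : Set (Fin (r + 1) → ℂ)) := by
    rw [hE, R.componentsOf_zeroSet]
  have hbranch : ∀ τ ∈ twists m, branch d p a m q N τ ⊆ E := fun τ hτ => by
    rw [hE, R.zeroSet_fermatSystem]
    exact Set.subset_sUnion_of_mem ⟨τ, hτ, rfl⟩
  -- `A` is represented by a vector whose last coordinates vanish
  obtain ⟨x, rfl⟩ : ∃ x, WeightedProjQuot.mk x = A := Quotient.exists_rep A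
  have hAx : ∀ i ∈ tailIdx r, WeightedProjQuot.mk x ∈
      E ∩ (WeightedProjQuot.hyperplane i : Set (WeightedProjQuot r d p a)) := fun i hi => by
    rw [hA i hi]
    rfl
  have hx : ∀ i ∈ tailIdx r, x.1 i = 0 := fun i hi =>
    WeightedProjQuot.mk_mem_hyperplane_iff.1 (hAx i hi).2
  have hPpos : 0 < P := by
    rw [hP]
    exact Finset.prod_pos fun i _ => hp i
  have hPi : ∀ i ∈ tailIdx r, (p i : ℤ) * ∏ j ∈ (tailIdx r).erase i, (p j : ℤ) = P := by
    intro i hi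
    rw [Finset.mul_prod_erase (tailIdx r) (fun j => (p j : ℤ)) hi, hP, Nat.cast_prod]
  have hQ : ∀ i ∈ tailIdx r, (a i * ∏ j ∈ (tailIdx r).erase i, (p j : ℤ)) * g = b * P := by
    intro i hi
    have h1 : (p i : ℤ) = g * q i := by exact_mod_cast R.p_eq i hi
    have h2 := hPi i hi
    rw [R.a_eq i hi, ← h2, h1]
    ring
  refine ⟨⟨?_, ?_⟩, ⟨?_, ?_⟩, a 2 * ∏ j ∈ (tailIdx r).erase 2, (p j : ℤ), fun i hi => ?_, ?_⟩
  · rw [hcomp]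
    exact (Finset.finite_toSet _).image _
  · have hN : (N : ℚ) ≠ 0 := by exact_mod_cast R.N_pos.ne'
    rw [hcomp, ← R.eq_lcm, eq_div_iff hN]
    exact_mod_cast R.ncard_branches
  · rw [hcomp]
    rintro _ ⟨τ, hτ, rfl⟩
    have hxE := (hAx 2 h2).1
    rw [hE, R.zeroSet_fermatSystem] at hxE
    obtain ⟨_, ⟨τ', hτ', rfl⟩, hxτ'⟩ := hxE
    obtain ⟨s, h0, hs⟩ := R.mk_mem_branch_iff.1 hxτ'
    have hs0 : s = 0 := by
      have := hs 2 h2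
      rw [hx 2 h2] at this
      exact pow_eq_zero_iff (R.q_pos h2).ne' |>.1
        ((mul_eq_zero.1 this.symm).resolve_right (R.twist_ne_zero hτ' h2))
    refine R.mk_mem_branch_iff.2 ⟨s, h0, fun i hi => ?_⟩
    rw [hx i hi, hs0, zero_pow (R.q_pos hi).ne', zero_mul]
  · rw [hcomp]
    rintro _ ⟨τ, hτ, rfl⟩ _ ⟨τ', hτ', rfl⟩ hne
    rw [Set.disjoint_left]
    rintro _ ⟨⟨y, hy, rfl⟩, hyA⟩ ⟨hy', -⟩
    refine hne (R.branch_eq_of_mem hy (R.mk_mem_branch_iff.1 hy') h2 fun hy2 => hyA ?_)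
    rw [← hA 2 h2]
    exact ⟨hbranch τ hτ ⟨y, hy, rfl⟩, WeightedProjQuot.mk_mem_hyperplane_iff.2 hy2⟩
  · have hg0 : (g : ℤ) ≠ 0 := by exact_mod_cast R.g_pos.ne'
    exact mul_right_cancel₀ hg0 ((hQ 2 h2).trans (hQ i hi).symm)
  · rw [hcomp]
    rintro _ ⟨τ, hτ, rfl⟩
    exact ⟨R.ncard_branch_inter_hyperplane_eq hτ (Or.inl ⟨rfl, rfl⟩) hg hPpos (hQ 2 h2),
      R.ncard_branch_inter_hyperplane_eq hτ (Or.inr ⟨rfl, rfl⟩) hg hPpos (hQ 2 h2)⟩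

end
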